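/- **Setting.** Fix a horizon $T$, $\gamma>0$ and real matrices $A^0_t,B^0_t,S^0_t,A_t,B_t,S_t,E_t$ and symmetric $Q_t,Q^0_t,R_t,R^0_t,F_t,P_t,H_t$ ($1\le t\le T$), none depending on the number $n\ge 1$ of followers. A leader (index $0$) and followers $i=1,\dots,n$ evolve by $$x^0_{t+1}=A^0_tx^0_t+B^0_tu^0_t+S^0_t\bar x_t+d^0_t+w^0_t,\qquad x^i_{t+1}=A_tx^i_t+B_tu^i_t+S_t\bar x_t+E_tx^0_t+d^i_t+w^i_t,$$ where $\bar x_t,\bar u_t,\bar d_t$ are the averages over the followers of $x^i_t,u^i_t,d^i_t$. The initial states and the noises are square integrable and mutually independent, the noises have mean zero, the followers' initial states are i.i.d. with mean $\hat m_1$, and for each $t$ the followers' noises are i.i.d.; their covariance matrices do not depend on $n$. The disturbances $d$ are non-anticipative (at time $t$ they depend on the initial states and on the noises before $t$) and square integrable. The cost is $$J_n(\mathbf g,\mathbf d)=\mathbb E\sum_{t=1}^T\Big[\tfrac1n\sum_{i=1}^n\big(x_t^{i\top}Q_tx^i_t+u_t^{i\top}R_tu^i_t-\gamma^2|d^i_t|^2\big)+x_t^{0\top}Q^0_tx^0_t+u_t^{0\top}R^0_tu^0_t-\gamma^2|d^0_t|^2+(\bar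 x_t-x^0_t)^\top F_t(\bar x_t-x^0_t)+\bar x_t^\top P_t\bar x_t+\bar u_t^\top H_t\bar u_t\Big],$$ and $J_n^*=\inf_{\mathbf g}\sup_{\mathbf d}J_n(\mathbf g,\mathbf d)$, the infimum being over measurable mean-field sharing strategies $u^0_t=g^0_t(x^0_t,\bar x_t)$, $u^i_t=g^i_t(x^i_t,\bar x_t,x^0_t)$. Put $$\bar A_t=\begin{bmatrix}A^0_t&S^0_t\\E_t&A_t+S_t\end{bmatrix},\ \bar B_t=\begin{bmatrix}B^0_t&0\\0&B_t\end{bmatrix},\ \bar Q_t=\begin{bmatrix}Q^0_t+F_t&-F_t\\-F_t&Q_t+P_t+F_t\end{bmatrix},\ \bar R_t=\begin{bmatrix}R^0_t&0\\0&H_t+R_t\end{bmatrix}.$$ Let $\breve M_{T+1}=0$, $\breve\Delta_t=I+B_tR_t^{-1}B_t^\top\breve M_{t+1}-\gamma^{-2}\breve M_{t+1}$, $\breve M_t=Q_t+A_t^\top\breve M_{t+1}\breve\Delta_t^{-1}A_t$, $\breve L_t=-R_t^{-1}B_t^\top\breve M_{t+1}\breve\Delta_t^{-1}A_t$, and let $\bar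 M_t,\bar\Delta_t,\bar L_t$ be defined by the same formulas from $\bar A_t,\bar B_t,\bar Q_t,\bar R_t$; write $\bar L_t=\begin{bmatrix}\bar L^{1,1}_t&\bar L^{1,2}_t\\\bar L^{2,1}_t&\bar L^{2,2}_t\end{bmatrix}$. The worst-case disturbance is given by $d^i_t-\bar d_t=\gamma^{-2}\breve M_{t+1}\breve\Delta_t^{-1}A_t(x^i_t-\bar x_t)$ and $\begin{bmatrix}d^0_t\\\bar d_t\end{bmatrix}=\gamma^{-2}\bar M_{t+1}\bar\Delta_t^{-1}\bar A_t\begin{bmatrix}x^0_t\\\bar x_t\end{bmatrix}$. Under intermittent mean-field sharing, $\bar x_t$ is observed only at the times $t$ of an arbitrary (possibly empty) set. Starting from $\hat m_1$, let $\hat m_{t+1}=\bar x_{t+1}$ if the mean-field is observed at time $t+1$, and otherwise $$\hat m_{t+1}=(A_t+S_t+B_t\bar L^{2,2}_t)\hat m_t+(B_t\bar L^{2,1}_t+E_t)x^0_t+\bar d_t .$$ The approximate strategy $\mathbf v$ is $v^0_t=\bar L^{1,1}_tx^0_t+\bar L^{1,2}_t\hat m_t$, $v^i_t=\breve L_tx^i_t+\bar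 L^{2,1}_tx^0_t+(\bar L^{2,2}_t-\breve L_t)\hat m_t$. **Theorem.** Assume that for $1\le t\le T$ the matrices $Q_t,\bar Q_t$ are positive semi-definite and $R_t,\bar R_t$ positive definite, and that $\gamma^2I-\breve M_{t+1}$ and $\gamma^2I-\bar M_{t+1}$ are positive definite for $1\le t\le T-1$ (so that the mean-field sharing saddle point exists). Then there is $\varepsilon(n)\ge0$ with $\varepsilon(n)=O(1/n)$, hence $\varepsilon(n)\to0$, depending only on $T$, $\gamma$, the model matrices and the followers' covariance matrices, such that for every $n\ge1$ both $J_n^*$ and $\sup_{\mathbf d}J_n(\mathbf v,\mathbf d)$ are finite and $$\Big|\sup_{\mathbf d}J_n(\mathbf v,\mathbf d)-J_n^*\Big|\le\varepsilon(n).$$ Moreover, if in the recursion of $\hat m_t$ the term $\bar d_t$ is replaced by its worst-case value computed from $(x^0_t,\hat m_t)$ in place of $(x^0_t,\bar x_t)$, so that $\hat m_t$ depends only on the leader's states and the shared observations, then the cost of the resulting strategy under the worst-case disturbance also differs from $J_n^*$ by at most $\varepsilon(n)$. -/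

import Mathlib

open MeasureTheory ProbabilityTheory Filter Topology Asymptotics
open scoped Matrix ENNReal

noncomputable section

namespace LeaderFollower

/-! ### Profiles: one vector for the leader and one for each follower -/

/-- A vector for the leader (index `none`) and for each of the `n` followers (index `some i`). -/
abbrev Profile (n ℓ : ℕ) : Type := Option (Fin n) → Fin ℓ → ℝ

/-- The aggregate `(1/n) ∑ i, p i` over the followers. -/
def Profile.agg {n ℓ : ℕ} (p : Profile n ℓ) : Fin ℓ → ℝ :=
  (n : ℝ)⁻¹ • ∑ i : Fin n, p (some i)

/-- The quadratic form `vᵀ K v`. -/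
def quad {ℓ : ℕ} (K : Matrix (Fin ℓ) (Fin ℓ) ℝ) (v : Fin ℓ → ℝ) : ℝ := v ⬝ᵥ (K *ᵥ v)

/-! ### The model matrices -/

/-- The (time-varying) matrices of the dynamics and of the cost. They do not involve the number
of followers. Symmetry of the cost matrices on the horizon is part of `Model.Convexity`. -/
structure Model (ℓx ℓu : ℕ) where
  A0 : ℕ → Matrix (Fin ℓx) (Fin ℓx) ℝ
  B0 : ℕ → Matrix (Fin ℓx) (Fin ℓu) ℝ
  S0 : ℕ → Matrix (Fin ℓx) (Fin ℓx) ℝ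
  A : ℕ → Matrix (Fin ℓx) (Fin ℓx) ℝ
  B : ℕ → Matrix (Fin ℓx) (Fin ℓu) ℝ
  S : ℕ → Matrix (Fin ℓx) (Fin ℓx) ℝ
  E : ℕ → Matrix (Fin ℓx) (Fin ℓx) ℝ
  Q : ℕ → Matrix (Fin ℓx) (Fin ℓx) ℝ
  Q0 : ℕ → Matrix (Fin ℓx) (Fin ℓx) ℝ
  R : ℕ → Matrix (Fin ℓu) (Fin ℓu) ℝ
  R0 : ℕ → Matrix (Fin ℓu) (Fin ℓu) ℝ
  F : ℕ → Matrix (Fin ℓx) (Fin ℓx) ℝ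
  P : ℕ → Matrix (Fin ℓx) (Fin ℓx) ℝ
  H : ℕ → Matrix (Fin ℓu) (Fin ℓu) ℝ

/-! ### Riccati recursion of a soft-constrained linear-quadratic game -/

section Riccati

variable {p q : Type} [Fintype p] [DecidableEq p] [Fintype q] [DecidableEq q]

/-- `Δ = I + B R⁻¹ Bᵀ M - γ⁻² M`. -/
def delta (γ : ℝ) (B : Matrix p q ℝ) (R : Matrix q q ℝ) (M : Matrix p p ℝ) : Matrix p p ℝ :=
  1 + B * R⁻¹ * Bᵀ * M - (γ ^ 2)⁻¹ • M

/-- The Riccati matrix with `k` steps to go, i.e. at time `T + 1 - k`. -/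
def riccatiToGo (γ : ℝ) (T : ℕ) (A : ℕ → Matrix p p ℝ) (B : ℕ → Matrix p q ℝ)
    (Q : ℕ → Matrix p p ℝ) (R : ℕ → Matrix q q ℝ) : ℕ → Matrix p p ℝ
  | 0 => 0
  | k + 1 =>
      Q (T - k) + (A (T - k))ᵀ * riccatiToGo γ T A B Q R k *
        (delta γ (B (T - k)) (R (T - k)) (riccatiToGo γ T A B Q R k))⁻¹ * A (T - k)

/-- The Riccati matrix `M t`. -/
def riccati (γ : ℝ) (T : ℕ) (A : ℕ → Matrix p p ℝ) (B : ℕ → Matrix p q ℝ)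
    (Q : ℕ → Matrix p p ℝ) (R : ℕ → Matrix q q ℝ) (t : ℕ) : Matrix p p ℝ :=
  riccatiToGo γ T A B Q R (T + 1 - t)

/-- Terminal condition `M (T + 1) = 0`. -/
theorem riccati_terminal (γ : ℝ) (T : ℕ) (A : ℕ → Matrix p p ℝ) (B : ℕ → Matrix p q ℝ)
    (Q : ℕ → Matrix p p ℝ) (R : ℕ → Matrix q q ℝ) : riccati γ T A B Q R (T + 1) = 0 := by
  simp [riccati, riccatiToGo]

/-- Backward recursion `M t = Q t + (A t)ᵀ M (t + 1) (Δ t)⁻¹ A t`. -/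
theorem riccati_step (γ : ℝ) (T : ℕ) (A : ℕ → Matrix p p ℝ) (B : ℕ → Matrix p q ℝ)
    (Q : ℕ → Matrix p p ℝ) (R : ℕ → Matrix q q ℝ) (t : ℕ) (ht : t ≤ T) :
    riccati γ T A B Q R t = Q t + (A t)ᵀ * riccati γ T A B Q R (t + 1) *
      (delta γ (B t) (R t) (riccati γ T A B Q R (t + 1)))⁻¹ * A t := by
  obtain ⟨k, rfl⟩ := Nat.exists_eq_add_of_le ht
  have h1 : t + k + 1 - t = k + 1 := by omega
  have h2 : t + k + 1 - (t + 1) = k := by omega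
  have h3 : t + k - k = t := by omega
  simp only [riccati, h1, h2, riccatiToGo, h3]

/-- The saddle-point control gain `- R⁻¹ Bᵀ M (t + 1) Δ⁻¹ A` at time `t`. -/
def controlGain (γ : ℝ) (T : ℕ) (A : ℕ → Matrix p p ℝ) (B : ℕ → Matrix p q ℝ)
    (Q : ℕ → Matrix p p ℝ) (R : ℕ → Matrix q q ℝ) (t : ℕ) : Matrix q p ℝ :=
  -((R t)⁻¹ * (B t)ᵀ * riccati γ T A B Q R (t + 1) *
    (delta γ (B t) (R t) (riccati γ T A B Q R (t + 1)))⁻¹ * A t)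

/-- The worst-case disturbance gain `γ⁻² M (t + 1) Δ⁻¹ A` at time `t`. -/
def worstGain (γ : ℝ) (T : ℕ) (A : ℕ → Matrix p p ℝ) (B : ℕ → Matrix p q ℝ)
    (Q : ℕ → Matrix p p ℝ) (R : ℕ → Matrix q q ℝ) (t : ℕ) : Matrix p p ℝ :=
  (γ ^ 2)⁻¹ • (riccati γ T A B Q R (t + 1) *
    (delta γ (B t) (R t) (riccati γ T A B Q R (t + 1)))⁻¹ * A t)

end Riccati

namespace Model

variable {ℓx ℓu : ℕ} (M : Model ℓx ℓu)

/-! ### The matrices of the (leader, mean-field) subsystem -/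

def Abar (t : ℕ) : Matrix (Fin ℓx ⊕ Fin ℓx) (Fin ℓx ⊕ Fin ℓx) ℝ :=
  Matrix.fromBlocks (M.A0 t) (M.S0 t) (M.E t) (M.A t + M.S t)

def Bbar (t : ℕ) : Matrix (Fin ℓx ⊕ Fin ℓx) (Fin ℓu ⊕ Fin ℓu) ℝ :=
  Matrix.fromBlocks (M.B0 t) 0 0 (M.B t)

def Qbar (t : ℕ) : Matrix (Fin ℓx ⊕ Fin ℓx) (Fin ℓx ⊕ Fin ℓx) ℝ :=
  Matrix.fromBlocks (M.Q0 t + M.F t) (-M.F t) (-M.F t) (M.Q t + M.P t + M.F t)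

def Rbar (t : ℕ) : Matrix (Fin ℓu ⊕ Fin ℓu) (Fin ℓu ⊕ Fin ℓu) ℝ :=
  Matrix.fromBlocks (M.R0 t) 0 0 (M.H t + M.R t)

/-- The convexity assumption: `Q t`, `Qbar t` positive semi-definite and `R t`, `Rbar t` positive
definite on the horizon (symmetry included, which makes all cost matrices symmetric). -/
structure Convexity (T : ℕ) : Prop where
  Q_psd : ∀ t ∈ Finset.Icc 1 T, (M.Q t).PosSemidef
  Qbar_psd : ∀ t ∈ Finset.Icc 1 T, (M.Qbar t).PosSemidef
  R_pd : ∀ t ∈ Finset.Icc 1 T, (M.R t).PosDef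
  Rbar_pd : ∀ t ∈ Finset.Icc 1 T, (M.Rbar t).PosDef

/-- The Riccati matrix of the deviations from the mean-field. -/
def Mdev (γ : ℝ) (T t : ℕ) : Matrix (Fin ℓx) (Fin ℓx) ℝ := riccati γ T M.A M.B M.Q M.R t

/-- The Riccati matrix of the (leader, mean-field) subsystem. -/
def Mbar (γ : ℝ) (T t : ℕ) : Matrix (Fin ℓx ⊕ Fin ℓx) (Fin ℓx ⊕ Fin ℓx) ℝ :=
  riccati γ T M.Abar M.Bbar M.Qbar M.Rbar t

/-- The attenuation level is such that the feedback saddle point exists: `γ² I - Mdev (t + 1)` and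
`γ² I - Mbar (t + 1)` are positive definite for `t = 1, …, T - 1`. -/
structure Attenuation (γ : ℝ) (T : ℕ) : Prop where
  dev_pd : ∀ t ∈ Finset.Icc 1 (T - 1), (γ ^ 2 • (1 : Matrix (Fin ℓx) (Fin ℓx) ℝ) - M.Mdev γ T (t + 1)).PosDef
  bar_pd : ∀ t ∈ Finset.Icc 1 (T - 1), (γ ^ 2 • (1 : Matrix (Fin ℓx ⊕ Fin ℓx) (Fin ℓx ⊕ Fin ℓx) ℝ)
    - M.Mbar γ T (t + 1)).PosDef

/-- The gain acting on the deviations from the mean-field. -/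
def Ldev (γ : ℝ) (T t : ℕ) : Matrix (Fin ℓu) (Fin ℓx) ℝ := controlGain γ T M.A M.B M.Q M.R t

/-- The gain of the (leader, mean-field) subsystem. -/
def Lbar (γ : ℝ) (T t : ℕ) : Matrix (Fin ℓu ⊕ Fin ℓu) (Fin ℓx ⊕ Fin ℓx) ℝ :=
  controlGain γ T M.Abar M.Bbar M.Qbar M.Rbar t

/-- The worst-case pair (leader's disturbance, aggregate disturbance of the followers) when the
leader's state is `x0` and the mean-field is `m`. -/
def worstBar (γ : ℝ) (T t : ℕ) (x0 m : Fin ℓx → ℝ) : Fin ℓx ⊕ Fin ℓx → ℝ :=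
  worstGain γ T M.Abar M.Bbar M.Qbar M.Rbar t *ᵥ Sum.elim x0 m

/-- The worst-case value of the aggregate disturbance of the followers. -/
def worstAgg (γ : ℝ) (T t : ℕ) (x0 m : Fin ℓx → ℝ) : Fin ℓx → ℝ :=
  fun a => M.worstBar γ T t x0 m (Sum.inr a)

/-- The worst-case (state feedback) disturbance. -/
def worst {n : ℕ} (γ : ℝ) (T t : ℕ) (x : Profile n ℓx) : Profile n ℓx
  | none => fun a => M.worstBar γ T t (x none) x.agg (Sum.inl a)
  | some i => worstGain γ T M.A M.B M.Q M.R t *ᵥ (x (some i) - x.agg)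
      + M.worstAgg γ T t (x none) x.agg

/-! ### Dynamics and cost -/

/-- One step of the dynamics: the states at time `t + 1` from states, actions, disturbances and
noises at time `t`. -/
def step {n : ℕ} (t : ℕ) (x : Profile n ℓx) (u : Profile n ℓu) (d w : Profile n ℓx) :
    Profile n ℓx
  | none => M.A0 t *ᵥ x none + M.B0 t *ᵥ u none + M.S0 t *ᵥ x.agg + d none + w none
  | some i => M.A t *ᵥ x (some i) + M.B t *ᵥ u (some i) + M.S t *ᵥ x.agg + M.E t *ᵥ x none
      + d (some i) + w (some i)

/-- The cost at time `t`. -/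
def stageCost {n : ℕ} (γ : ℝ) (t : ℕ) (x : Profile n ℓx) (u : Profile n ℓu) (d : Profile n ℓx) :
    ℝ :=
  (n : ℝ)⁻¹ * ∑ i : Fin n, (quad (M.Q t) (x (some i)) + quad (M.R t) (u (some i))
      - γ ^ 2 * (d (some i) ⬝ᵥ d (some i)))
    + quad (M.Q0 t) (x none) + quad (M.R0 t) (u none) - γ ^ 2 * (d none ⬝ᵥ d none)
    + quad (M.F t) (x.agg - x none) + quad (M.P t) x.agg + quad (M.H t) u.agg

end Model

/-! ### Primitive random variables and disturbances -/

/-- Initial states and noises. -/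
structure Primitives (n ℓx : ℕ) (Ω : Type*) where
  init : Ω → Profile n ℓx
  noise : ℕ → Ω → Profile n ℓx

/-- All primitive variables as one sequence: the initial states, then the noises of times
`1, 2, …`. -/
def Primitives.seq {n ℓx : ℕ} {Ω : Type*} (N : Primitives n ℓx Ω) (s : ℕ) : Ω → Profile n ℓx :=
  if s = 0 then N.init else N.noise s

/-- The probabilistic assumptions: the initial states and the noises of times `1, …, T` of all
agents are square integrable and mutually independent, noises have zero mean, and the followers'
initial states (respectively noises of time `t`) are identically distributed, with mean `m` and
covariance matrix `Cinit` (respectively mean zero and covariance matrix `Cnoise t`). -/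
structure Primitives.Standing {n ℓx : ℕ} {Ω : Type*} [MeasurableSpace Ω]
    (N : Primitives n ℓx Ω) (μ : Measure Ω) (T : ℕ) (m : Fin ℓx → ℝ)
    (Cinit : Matrix (Fin ℓx) (Fin ℓx) ℝ) (Cnoise : ℕ → Matrix (Fin ℓx) (Fin ℓx) ℝ) : Prop where
  measurable : ∀ s ≤ T, Measurable (N.seq s)
  memLp : ∀ s ≤ T, MemLp (N.seq s) 2 μ
  indep : iIndepFun (fun (k : Fin (T + 1) × Option (Fin n)) (ω : Ω) => N.seq k.1 ω k.2) μ
  noise_mean : ∀ t ∈ Finset.Icc 1 T, ∀ a, ∫ ω, N.noise t ω a ∂μ = 0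
  init_ident : ∀ i j : Fin n,
    IdentDistrib (fun ω => N.init ω (some i)) (fun ω => N.init ω (some j)) μ μ
  noise_ident : ∀ t ∈ Finset.Icc 1 T, ∀ i j : Fin n,
    IdentDistrib (fun ω => N.noise t ω (some i)) (fun ω => N.noise t ω (some j)) μ μ
  init_mean : ∀ i : Fin n, ∫ ω, N.init ω (some i) ∂μ = m
  init_cov : ∀ (i : Fin n) (a b : Fin ℓx),
    covariance (fun ω => N.init ω (some i) a) (fun ω => N.init ω (some i) b) μ = Cinit a b
  noise_cov : ∀ t ∈ Finset.Icc 1 T, ∀ (i : Fin n) (a b : Fin ℓx),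
    covariance (fun ω => N.noise t ω (some i) a) (fun ω => N.noise t ω (some i) b) μ
      = Cnoise t a b

/-- The information generated by the initial states and the noises before time `t`. -/
@[reducible] def Primitives.past {n ℓx : ℕ} {Ω : Type*} (N : Primitives n ℓx Ω) (t : ℕ) : MeasurableSpace Ω :=
  ⨆ s : ℕ, ⨆ _ : s < t, MeasurableSpace.comap (N.seq s) inferInstance

/-- An admissible disturbance: non-anticipative and of finite energy. Every finite-energy
disturbance generated by feedback of the states is of this kind. -/
structure Disturbance {n ℓx : ℕ} {Ω : Type*} [MeasurableSpace Ω] (N : Primitives n ℓx Ω)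
    (μ : Measure Ω) where
  val : ℕ → Ω → Profile n ℓx
  adapted : ∀ t, Measurable[N.past t] (val t)
  memLp : ∀ t, MemLp (val t) 2 μ

/-! ### Closed loops -/

/-- A strategy under mean-field sharing: `u⁰ = g⁰ (x⁰, x̄)` and `uⁱ = gⁱ (xⁱ, x̄, x⁰)`. -/
structure MFSStrategy (n ℓx ℓu : ℕ) where
  leader : ℕ → (Fin ℓx → ℝ) × (Fin ℓx → ℝ) → Fin ℓu → ℝ
  follower : ℕ → Fin n → (Fin ℓx → ℝ) × (Fin ℓx → ℝ) × (Fin ℓx → ℝ) → Fin ℓu → ℝ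
  measurable_leader : ∀ t, Measurable (leader t)
  measurable_follower : ∀ t i, Measurable (follower t i)

/-- The actions prescribed by a mean-field sharing strategy. -/
def MFSStrategy.action {n ℓx ℓu : ℕ} (g : MFSStrategy n ℓx ℓu) (t : ℕ) (x : Profile n ℓx) :
    Profile n ℓu
  | none => g.leader t (x none, x.agg)
  | some i => g.follower t i (x (some i), x.agg, x none)

/-- What is shared at time `t`: the mean-field at the observation times `obs`, blank otherwise. -/
def signal {n ℓx : ℕ} (obs : Finset ℕ) (t : ℕ) (x : Profile n ℓx) : Option (Fin ℓx → ℝ) :=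
  if t ∈ obs then some x.agg else none

namespace Model

variable {ℓx ℓu : ℕ} (M : Model ℓx ℓu) {n : ℕ}

/-- States under a mean-field sharing strategy, along given initial states `x₁`, disturbances `d`
and noises `w`. Time starts at `1` (the value at `0` is not used). -/
def mfsState (g : MFSStrategy n ℓx ℓu) (x₁ : Profile n ℓx) (d w : ℕ → Profile n ℓx) :
    ℕ → Profile n ℓx
  | 0 => x₁
  | 1 => x₁
  | t + 2 => M.step (t + 1) (mfsState g x₁ d w (t + 1))
      (g.action (t + 1) (mfsState g x₁ d w (t + 1))) (d (t + 1)) (w (t + 1))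

/-- The saddle-point strategy with the mean-field replaced by the estimate `mhat`. -/
def approxAction (γ : ℝ) (T t : ℕ) (x : Profile n ℓx) (mhat : Fin ℓx → ℝ) : Profile n ℓu
  | none => (M.Lbar γ T t).toBlocks₁₁ *ᵥ x none + (M.Lbar γ T t).toBlocks₁₂ *ᵥ mhat
  | some i => M.Ldev γ T t *ᵥ x (some i) + (M.Lbar γ T t).toBlocks₂₁ *ᵥ x none
      + ((M.Lbar γ T t).toBlocks₂₂ - M.Ldev γ T t) *ᵥ mhat

/-- The estimate at time `t + 1` from the estimate `mhat` and the leader's state `x0` at time `t`,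
the value `dbar` used for the aggregate disturbance of time `t`, and the signal `z` of time
`t + 1`. -/
def nextEstimate (γ : ℝ) (T t : ℕ) (mhat x0 dbar : Fin ℓx → ℝ) (z : Option (Fin ℓx → ℝ)) :
    Fin ℓx → ℝ :=
  match z with
  | some xbar => xbar
  | none => (M.A t + M.S t + M.B t * (M.Lbar γ T t).toBlocks₂₂) *ᵥ mhat
      + (M.B t * (M.Lbar γ T t).toBlocks₂₁ + M.E t) *ᵥ x0 + dbar

/-- States and estimate under the approximate strategy. Here `dist t x` is the disturbance of time
`t` when the state is `x` (constant in `x` for a disturbance given as a process), and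
`dbar t x0 mhat d` is the value of the aggregate disturbance that enters the estimate when the
leader's state is `x0`, the estimate is `mhat` and the disturbance is `d`. -/
def approxState (γ : ℝ) (T : ℕ) (obs : Finset ℕ) (m : Fin ℓx → ℝ)
    (dbar : ℕ → (Fin ℓx → ℝ) → (Fin ℓx → ℝ) → Profile n ℓx → Fin ℓx → ℝ)
    (x₁ : Profile n ℓx) (dist : ℕ → Profile n ℓx → Profile n ℓx) (w : ℕ → Profile n ℓx) :
    ℕ → Profile n ℓx × (Fin ℓx → ℝ)
  | 0 => (x₁, m)
  | 1 => (x₁, m)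
  | t + 2 =>
      let x := (approxState γ T obs m dbar x₁ dist w (t + 1)).1
      let mhat := (approxState γ T obs m dbar x₁ dist w (t + 1)).2
      let d := dist (t + 1) x
      let y := M.step (t + 1) x (M.approxAction γ T (t + 1) x mhat) d (w (t + 1))
      (y, M.nextEstimate γ T (t + 1) mhat (x none) (dbar (t + 1) (x none) mhat d)
        (signal obs (t + 2) y))

/-- The extended expectation `E f⁺ - E f⁻`. -/
def extExpectation {Ω : Type*} [MeasurableSpace Ω] (μ : Measure Ω) (f : Ω → ℝ) : EReal :=
  ((∫⁻ ω, ENNReal.ofReal (f ω) ∂μ : ℝ≥0∞) : EReal)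
    - ((∫⁻ ω, ENNReal.ofReal (-f ω) ∂μ : ℝ≥0∞) : EReal)

variable {Ω : Type*} [MeasurableSpace Ω]

/-- The cost of a mean-field sharing strategy `g` under the disturbance `d`. -/
def mfsCost (γ : ℝ) (T : ℕ) (N : Primitives n ℓx Ω) (μ : Measure Ω) (g : MFSStrategy n ℓx ℓu)
    (d : Disturbance N μ) : EReal :=
  extExpectation μ fun ω => ∑ t ∈ Finset.Icc 1 T,
    let x := M.mfsState g (N.init ω) (fun s => d.val s ω) (fun s => N.noise s ω) t
    M.stageCost γ t x (g.action t x) (d.val t ω)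

/-- The value `inf_g sup_d J(g, d)` under mean-field sharing. -/
def saddleValue (γ : ℝ) (T : ℕ) (N : Primitives n ℓx Ω) (μ : Measure Ω) : EReal :=
  ⨅ g : MFSStrategy n ℓx ℓu, ⨆ d : Disturbance N μ, M.mfsCost γ T N μ g d

/-- The cost of the approximate strategy under the disturbance `d`; the estimate is driven by the
aggregate disturbance. -/
def approxCost (γ : ℝ) (T : ℕ) (N : Primitives n ℓx Ω) (μ : Measure Ω) (obs : Finset ℕ)
    (m : Fin ℓx → ℝ) (d : Disturbance N μ) : EReal :=
  extExpectation μ fun ω => ∑ t ∈ Finset.Icc 1 T,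
    let s := M.approxState γ T obs m (fun _ _ _ e => e.agg) (N.init ω)
      (fun r _ => d.val r ω) (fun r => N.noise r ω) t
    M.stageCost γ t s.1 (M.approxAction γ T t s.1 s.2) (d.val t ω)

/-- The cost, under the worst-case disturbance, of the approximate strategy whose estimate is
computed with the worst-case value of the aggregate disturbance (evaluated at the leader's state and
the estimate), hence from the leader's states and the shared signals only. -/
def approxCostAtWorst (γ : ℝ) (T : ℕ) (N : Primitives n ℓx Ω) (μ : Measure Ω) (obs : Finset ℕ)
    (m : Fin ℓx → ℝ) : EReal :=
  extExpectation μ fun ω => ∑ t ∈ Finset.Icc 1 T,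
    let s := M.approxState γ T obs m (fun r x0 mhat _ => M.worstAgg γ T r x0 mhat) (N.init ω)
      (fun r x => M.worst γ T r x) (fun r => N.noise r ω) t
    M.stageCost γ t s.1 (M.approxAction γ T t s.1 s.2) (M.worst γ T t s.1)

end Model

end LeaderFollower

end

/-!
The states, actions and disturbances of the population split into the deviations of the followers
from the mean-field and the pair (leader, mean-field). In these coordinates the dynamics and the
cost decouple (`Model.dev_step`, `Model.bar_step`, `Model.stageCost_eq`) into soft-constrained
linear-quadratic games, each governed by one of the two Riccati recursions.

In one such game the Riccati matrices are positive semi-definite and `Δ` is invertible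
(`riccati_posSemidef`, `isUnit_det_delta`), and completing squares at the critical point of the
one-step cost-to-go gives `stage_completion`: stage cost plus next value equals current value plus
a quadratic `gapForm` in the departures of control and disturbance from the saddle point. The gap
is nonnegative if the disturbance is the worst case, nonpositive if the control is optimal, and
always at most a constant times the squared departure of the control. Summing over time, and
since the noise is orthogonal to everything determined before it, the expected cost of any
non-anticipative closed loop of finite energy is a constant `gameValue` plus the expected gaps
(`ClosedLoop.integral_cost`).

This identifies `J⋆` with `gameValue` (`Model.saddleValue_eq`). The saddle-point strategy makes all
gaps nonpositive. Conversely, against any measurable strategy the worst-case feedback makes all gaps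
nonnegative; it is admissible unless the strategy already has infinite cost against some disturbance
(`Model.known_worstState`).

The approximate strategy is optimal on the deviations, and departs from the optimum on the pair
(leader, mean-field) by a gain times the estimation error `m̂ - x̄`. The point is that this error
does not feel the disturbance: it is reset at the observation times and otherwise satisfies a linear
recursion driven by the averaged noise (`Model.approxError_succ`). It starts from the centred
average of the initial states, so its mean square is `O(1/n)` (`Model.integral_error_le`), and so are the
gaps, uniformly in the disturbance. The worst-case feedback shows that the supremum is not below
`gameValue`. If the aggregate disturbance is itself estimated, the same holds under the worst-case
feedback, with another matrix in the error recursion.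
-/

noncomputable section

namespace LeaderFollower

/-! ### Quadratic forms of real matrices -/

section QuadraticForms

theorem transpose_eq_of_posSemidef {p : Type} {M : Matrix p p ℝ} (hM : M.PosSemidef) : Mᵀ = M := by
  have := hM.isHermitian
  rwa [Matrix.IsHermitian, Matrix.conjTranspose_eq_transpose_of_trivial] at this

variable {p q : Type} [Fintype p] [Fintype q]

theorem dotProduct_mulVec_comm {M : Matrix p p ℝ} (hM : Mᵀ = M) (v w : p → ℝ) :
    v ⬝ᵥ (M *ᵥ w) = w ⬝ᵥ (M *ᵥ v) := by
  rw [Matrix.dotProduct_mulVec, ← Matrix.mulVec_transpose, hM, dotProduct_comm]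

/-- The sum of the absolute values of the entries, a crude bound for the operator norm. -/
def absSum (W : Matrix p p ℝ) : ℝ := ∑ i, ∑ j, |W i j|

theorem absSum_nonneg (W : Matrix p p ℝ) : 0 ≤ absSum W :=
  Finset.sum_nonneg fun _ _ => Finset.sum_nonneg fun _ _ => abs_nonneg _

theorem dotProduct_self_nonneg (v : p → ℝ) : 0 ≤ v ⬝ᵥ v :=
  Finset.sum_nonneg fun _ _ => mul_self_nonneg _

theorem mul_self_le_dotProduct_self (v : p → ℝ) (i : p) : v i * v i ≤ v ⬝ᵥ v :=
  Finset.single_le_sum (f := fun i => v i * v i) (fun _ _ => mul_self_nonneg _)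
    (Finset.mem_univ i)

theorem dotProduct_mulVec_le_absSum (W : Matrix p p ℝ) (v : p → ℝ) :
    v ⬝ᵥ (W *ᵥ v) ≤ absSum W * (v ⬝ᵥ v) := by
  have h : v ⬝ᵥ (W *ᵥ v) = ∑ i, ∑ j, v i * (W i j * v j) := by
    simp [dotProduct, Matrix.mulVec, Finset.mul_sum]
  rw [h, absSum, Finset.sum_mul]
  refine Finset.sum_le_sum fun i _ => ?_
  rw [Finset.sum_mul]
  refine Finset.sum_le_sum fun j _ => ?_
  have hi := mul_self_le_dotProduct_self v i
  have hj := mul_self_le_dotProduct_self v j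
  have h1 : |v i * v j| ≤ v ⬝ᵥ v := by
    rw [abs_le]
    constructor <;> nlinarith [sq_nonneg (v i + v j), sq_nonneg (v i - v j)]
  calc v i * (W i j * v j) = W i j * (v i * v j) := by ring
    _ ≤ |W i j * (v i * v j)| := le_abs_self _
    _ = |W i j| * |v i * v j| := abs_mul _ _
    _ ≤ |W i j| * (v ⬝ᵥ v) := mul_le_mul_of_nonneg_left h1 (abs_nonneg _)

theorem mulVec_dotProduct_mulVec (W : Matrix p q ℝ) (v : q → ℝ) :
    (W *ᵥ v) ⬝ᵥ (W *ᵥ v) = v ⬝ᵥ ((Wᵀ * W) *ᵥ v) := by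
  rw [← Matrix.mulVec_mulVec, Matrix.dotProduct_mulVec v, ← Matrix.mulVec_transpose,
    Matrix.transpose_transpose]

theorem mulVec_dotProduct_mulVec_le (W : Matrix p q ℝ) (v : q → ℝ) :
    (W *ᵥ v) ⬝ᵥ (W *ᵥ v) ≤ absSum (Wᵀ * W) * (v ⬝ᵥ v) := by
  rw [mulVec_dotProduct_mulVec]
  exact dotProduct_mulVec_le_absSum _ _

theorem dotProduct_mulVec_nonneg {M : Matrix p p ℝ} (hM : M.PosSemidef) (v : p → ℝ) :
    0 ≤ v ⬝ᵥ (M *ᵥ v) := by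
  simpa using hM.dotProduct_mulVec_nonneg v

theorem posSemidef_of_dotProduct_mulVec_nonneg {M : Matrix p p ℝ} (hM : Mᵀ = M)
    (h : ∀ v, 0 ≤ v ⬝ᵥ (M *ᵥ v)) : M.PosSemidef :=
  Matrix.PosSemidef.of_dotProduct_mulVec_nonneg
    (by rwa [Matrix.IsHermitian, Matrix.conjTranspose_eq_transpose_of_trivial])
    (fun v => by simpa using h v)

variable [DecidableEq p]

theorem isUnit_det_of_posDef {K : Matrix p p ℝ} (hK : K.PosDef) : IsUnit K.det :=
  (Matrix.isUnit_iff_isUnit_det K).1 hK.isUnit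

/-- Completion of the square: `a ⬝ᵥ K⁻¹ a` is the maximum over `d` of `2 a ⬝ᵥ d - d ⬝ᵥ K d`. -/
theorem two_mul_dotProduct_sub_le {K : Matrix p p ℝ} (hK : K.PosDef) (a d : p → ℝ) :
    2 * (a ⬝ᵥ d) - d ⬝ᵥ (K *ᵥ d) ≤ a ⬝ᵥ (K⁻¹ *ᵥ a) := by
  have hu := isUnit_det_of_posDef hK
  have hs := transpose_eq_of_posSemidef hK.posSemidef
  have h := dotProduct_mulVec_nonneg hK.posSemidef (d - K⁻¹ *ᵥ a)
  have e1 : K *ᵥ (K⁻¹ *ᵥ a) = a := by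
    rw [Matrix.mulVec_mulVec, Matrix.mul_nonsing_inv _ hu, Matrix.one_mulVec]
  rw [Matrix.mulVec_sub, e1, sub_dotProduct, dotProduct_sub, dotProduct_sub,
    dotProduct_mulVec_comm hs (K⁻¹ *ᵥ a) d, e1, dotProduct_comm (K⁻¹ *ᵥ a) a,
    dotProduct_comm d a] at h
  linarith

/-- Coercivity of a positive definite form. -/
theorem dotProduct_self_le_mul_of_posDef {K : Matrix p p ℝ} (hK : K.PosDef) (d : p → ℝ) :
    d ⬝ᵥ d ≤ (absSum K⁻¹ + 1) * (d ⬝ᵥ (K *ᵥ d)) := by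
  set c := absSum K⁻¹ + 1 with hc
  have hc0 : 0 < c := by have := absSum_nonneg K⁻¹; linarith
  have h1 := two_mul_dotProduct_sub_le hK (c⁻¹ • d) d
  have h2 := dotProduct_mulVec_le_absSum K⁻¹ (c⁻¹ • d)
  have h3 := dotProduct_self_nonneg d
  simp only [smul_dotProduct, dotProduct_smul, smul_eq_mul, Matrix.mulVec_smul] at h1 h2
  have h4 : absSum K⁻¹ = c - 1 := by rw [hc]; ring
  rw [h4] at h2
  have h5 : (c - 1) * (c⁻¹ * (c⁻¹ * (d ⬝ᵥ d))) ≤ c⁻¹ * (d ⬝ᵥ d) := by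
    have : c⁻¹ * (d ⬝ᵥ d) - (c - 1) * (c⁻¹ * (c⁻¹ * (d ⬝ᵥ d))) = c⁻¹ * c⁻¹ * (d ⬝ᵥ d) := by
      field_simp; ring
    have h6 : 0 ≤ c⁻¹ * c⁻¹ * (d ⬝ᵥ d) := by positivity
    linarith
  have h7 : c⁻¹ * (d ⬝ᵥ d) ≤ d ⬝ᵥ (K *ᵥ d) := by linarith
  calc d ⬝ᵥ d = c * (c⁻¹ * (d ⬝ᵥ d)) := by field_simp
    _ ≤ c * (d ⬝ᵥ (K *ᵥ d)) := mul_le_mul_of_nonneg_left h7 hc0.le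

end QuadraticForms

/-! ### Completion of squares along the Riccati recursion -/

section Game

variable {p q : Type} [Fintype p] [Fintype q]

/-- `M² ≤ γ² M`, strictly off the kernel of `M`, whenever `0 ≤ M < γ² I`. -/
theorem mulVec_eq_zero_of_le [DecidableEq p] {γ : ℝ} (hγ : 0 < γ) {M : Matrix p p ℝ}
    (hM : M.PosSemidef)
    (hK : (γ ^ 2 • (1 : Matrix p p ℝ) - M).PosDef) {v : p → ℝ}
    (h : γ ^ 2 * (v ⬝ᵥ (M *ᵥ v)) ≤ (M *ᵥ v) ⬝ᵥ (M *ᵥ v)) : M *ᵥ v = 0 := by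
  by_contra hne
  -- Expand the form of `M` at `v - γ⁻² M v` and use `M < γ² I` at `M v`.
  set y := M *ᵥ v with hy
  have hs := transpose_eq_of_posSemidef hM
  have h1 : 0 < y ⬝ᵥ ((γ ^ 2 • (1 : Matrix p p ℝ) - M) *ᵥ y) := by
    simpa using hK.dotProduct_mulVec_pos hne
  rw [Matrix.sub_mulVec, Matrix.smul_mulVec, Matrix.one_mulVec, dotProduct_sub,
    dotProduct_smul, smul_eq_mul] at h1
  have h2 := dotProduct_mulVec_nonneg hM (v - (γ ^ 2)⁻¹ • y)
  rw [Matrix.mulVec_sub, Matrix.mulVec_smul, sub_dotProduct, dotProduct_sub, dotProduct_sub] at h2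
  simp only [smul_dotProduct, dotProduct_smul, smul_eq_mul] at h2
  rw [dotProduct_mulVec_comm hs v y, ← hy] at h2
  set a := v ⬝ᵥ y
  set b := y ⬝ᵥ y
  set c := y ⬝ᵥ (M *ᵥ y)
  have hg : 0 < γ ^ 2 := by positivity
  have h3 : 0 ≤ γ ^ 2 * (γ ^ 2 *
      (a - (γ ^ 2)⁻¹ * b - ((γ ^ 2)⁻¹ * b - (γ ^ 2)⁻¹ * ((γ ^ 2)⁻¹ * c)))) := by
    apply mul_nonneg hg.le (mul_nonneg hg.le _)
    linarith
  have h4 : γ ^ 2 * (γ ^ 2 * (a - (γ ^ 2)⁻¹ * b - ((γ ^ 2)⁻¹ * b - (γ ^ 2)⁻¹ * ((γ ^ 2)⁻¹ * c))))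
      = γ ^ 2 * (γ ^ 2 * a) - 2 * (γ ^ 2 * b) + c := by field_simp; ring
  have h5 : γ ^ 2 * (γ ^ 2 * a) ≤ γ ^ 2 * b := mul_le_mul_of_nonneg_left h hg.le
  linarith

theorem delta_mulVec [DecidableEq p] [DecidableEq q] (γ : ℝ) (B : Matrix p q ℝ)
    (R : Matrix q q ℝ) (M : Matrix p p ℝ) (z : p → ℝ) : delta γ B R M *ᵥ z
      = z + B *ᵥ (R⁻¹ *ᵥ (Bᵀ *ᵥ (M *ᵥ z))) - (γ ^ 2)⁻¹ • (M *ᵥ z) := by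
  simp [delta, Matrix.sub_mulVec, Matrix.add_mulVec, Matrix.smul_mulVec, Matrix.mulVec_mulVec,
    Matrix.mul_assoc]

/-- The form `M Δ`: with `M² ≤ γ² M` it dominates the form of `M B R⁻¹ Bᵀ M`, which makes `Δ`
invertible and `M Δ⁻¹` positive semi-definite. -/
theorem dotProduct_mulVec_delta [DecidableEq p] [DecidableEq q] (γ : ℝ) {B : Matrix p q ℝ}
    {R : Matrix q q ℝ} {M : Matrix p p ℝ} (hM : Mᵀ = M) (z : p → ℝ) :
    z ⬝ᵥ (M *ᵥ (delta γ B R M *ᵥ z)) = z ⬝ᵥ (M *ᵥ z)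
      + (Bᵀ *ᵥ (M *ᵥ z)) ⬝ᵥ (R⁻¹ *ᵥ (Bᵀ *ᵥ (M *ᵥ z))) - (γ ^ 2)⁻¹ * ((M *ᵥ z) ⬝ᵥ (M *ᵥ z)) := by
  rw [dotProduct_mulVec_comm hM, dotProduct_comm, delta_mulVec, dotProduct_sub, dotProduct_add,
    dotProduct_smul, smul_eq_mul, dotProduct_comm (M *ᵥ z) z, Matrix.dotProduct_mulVec (M *ᵥ z) B,
    ← Matrix.mulVec_transpose B]

theorem isUnit_det_delta [DecidableEq p] [DecidableEq q] {γ : ℝ} (hγ : 0 < γ)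
    {B : Matrix p q ℝ} {R : Matrix q q ℝ}
    {M : Matrix p p ℝ} (hM : M.PosSemidef) (hK : (γ ^ 2 • (1 : Matrix p p ℝ) - M).PosDef)
    (hR : R.PosDef) : IsUnit (delta γ B R M).det := by
  rw [isUnit_iff_ne_zero]
  intro h0
  obtain ⟨v, hv, hv0⟩ := Matrix.exists_mulVec_eq_zero_iff.2 h0
  have h1 := dotProduct_mulVec_delta γ (B := B) (R := R) (transpose_eq_of_posSemidef hM) v
  rw [hv0, Matrix.mulVec_zero, dotProduct_zero] at h1
  have h2 := dotProduct_mulVec_nonneg hR.inv.posSemidef (Bᵀ *ᵥ (M *ᵥ v))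
  have hg : 0 < γ ^ 2 := by positivity
  have h3 : M *ᵥ v = 0 := by
    apply mulVec_eq_zero_of_le hγ hM hK
    have : γ ^ 2 * (v ⬝ᵥ (M *ᵥ v)) ≤ γ ^ 2 * ((γ ^ 2)⁻¹ * ((M *ᵥ v) ⬝ᵥ (M *ᵥ v))) :=
      mul_le_mul_of_nonneg_left (by linarith) hg.le
    rwa [mul_inv_cancel_left₀ hg.ne'] at this
  rw [delta_mulVec, h3] at hv0
  simp at hv0
  exact hv hv0

theorem posSemidef_mul_delta_inv [DecidableEq p] [DecidableEq q] {γ : ℝ} (hγ : 0 < γ)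
    {B : Matrix p q ℝ} {R : Matrix q q ℝ}
    {M : Matrix p p ℝ} (hM : M.PosSemidef) (hK : (γ ^ 2 • (1 : Matrix p p ℝ) - M).PosDef)
    (hR : R.PosDef) : (M * (delta γ B R M)⁻¹).PosSemidef := by
  have hu := isUnit_det_delta (B := B) hγ hM hK hR
  have hs := transpose_eq_of_posSemidef hM
  have hRs := transpose_eq_of_posSemidef hR.inv.posSemidef
  set D := delta γ B R M with hD
  have hcomm : Dᵀ * M = M * D := by
    simp [hD, delta, Matrix.transpose_add, Matrix.transpose_sub, Matrix.transpose_mul, hs, hRs,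
      Matrix.mul_assoc, Matrix.add_mul, Matrix.sub_mul, Matrix.mul_add, Matrix.mul_sub]
  have huT : IsUnit Dᵀ.det := by rwa [Matrix.det_transpose]
  have hsym : (M * D⁻¹)ᵀ = M * D⁻¹ := by
    rw [Matrix.transpose_mul, hs, Matrix.transpose_nonsing_inv]
    calc (Dᵀ)⁻¹ * M = (Dᵀ)⁻¹ * (M * D) * D⁻¹ := by
          rw [Matrix.mul_assoc, Matrix.mul_assoc, Matrix.mul_nonsing_inv _ hu, Matrix.mul_one]
      _ = M * D⁻¹ := by
          rw [← hcomm, ← Matrix.mul_assoc, Matrix.nonsing_inv_mul _ huT, Matrix.one_mul]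
  refine posSemidef_of_dotProduct_mulVec_nonneg hsym fun v => ?_
  obtain ⟨z, rfl⟩ : ∃ z, v = D *ᵥ z :=
    ⟨D⁻¹ *ᵥ v, by rw [Matrix.mulVec_mulVec, Matrix.mul_nonsing_inv _ hu, Matrix.one_mulVec]⟩
  rw [← Matrix.mulVec_mulVec, Matrix.mulVec_mulVec _ D⁻¹ D, Matrix.nonsing_inv_mul _ hu,
    Matrix.one_mulVec, dotProduct_mulVec_comm hs, hD, dotProduct_mulVec_delta γ hs]
  have h2 := dotProduct_mulVec_nonneg hR.inv.posSemidef (Bᵀ *ᵥ (M *ᵥ z))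
  have hg : 0 < γ ^ 2 := by positivity
  rcases le_total (γ ^ 2 * (z ⬝ᵥ (M *ᵥ z))) ((M *ᵥ z) ⬝ᵥ (M *ᵥ z)) with h | h
  · simp [mulVec_eq_zero_of_le hγ hM hK h]
  · have : (γ ^ 2)⁻¹ * ((M *ᵥ z) ⬝ᵥ (M *ᵥ z)) ≤ (γ ^ 2)⁻¹ * (γ ^ 2 * (z ⬝ᵥ (M *ᵥ z))) :=
      mul_le_mul_of_nonneg_left h (by positivity)
    rw [inv_mul_cancel_left₀ hg.ne'] at this
    linarith

/-- The excess of the one-step cost-to-go over its saddle value, when control and disturbance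
depart by `u` and `d` from the saddle point. -/
def gapForm (γ : ℝ) (B : Matrix p q ℝ) (R : Matrix q q ℝ) (M : Matrix p p ℝ)
    (u : q → ℝ) (d : p → ℝ) : ℝ :=
  u ⬝ᵥ (R *ᵥ u) - γ ^ 2 * (d ⬝ᵥ d) + (B *ᵥ u + d) ⬝ᵥ (M *ᵥ (B *ᵥ u + d))

theorem gapForm_nonneg {γ : ℝ} {B : Matrix p q ℝ} {R : Matrix q q ℝ} {M : Matrix p p ℝ}
    (hM : M.PosSemidef) (hR : R.PosSemidef) (u : q → ℝ) : 0 ≤ gapForm γ B R M u 0 := by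
  have h1 := dotProduct_mulVec_nonneg hM (B *ᵥ u)
  have h2 := dotProduct_mulVec_nonneg hR u
  simp only [gapForm, dotProduct_zero, mul_zero, sub_zero, add_zero]
  positivity

theorem gapForm_nonpos [DecidableEq p] {γ : ℝ} {B : Matrix p q ℝ} {R : Matrix q q ℝ}
    {M : Matrix p p ℝ}
    (hK : (γ ^ 2 • (1 : Matrix p p ℝ) - M).PosDef) (d : p → ℝ) : gapForm γ B R M 0 d ≤ 0 := by
  have h := dotProduct_mulVec_nonneg hK.posSemidef d
  rw [Matrix.sub_mulVec, Matrix.smul_mulVec, Matrix.one_mulVec, dotProduct_sub,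
    dotProduct_smul, smul_eq_mul] at h
  simp only [gapForm, Matrix.mulVec_zero, dotProduct_zero, zero_add]
  linarith

/-- The matrix of the quadratic form `u ↦ max_d gapForm u d`. -/
def gapBound [DecidableEq p] (γ : ℝ) (B : Matrix p q ℝ) (R : Matrix q q ℝ) (M : Matrix p p ℝ) :
    Matrix q q ℝ :=
  R + Bᵀ * M * B + Bᵀ * M * (γ ^ 2 • (1 : Matrix p p ℝ) - M)⁻¹ * M * B

theorem gapForm_le [DecidableEq p] {γ : ℝ} {B : Matrix p q ℝ} {R : Matrix q q ℝ} {M : Matrix p p ℝ}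
    (hM : M.PosSemidef) (hK : (γ ^ 2 • (1 : Matrix p p ℝ) - M).PosDef) (u : q → ℝ) (d : p → ℝ) :
    gapForm γ B R M u d ≤ absSum (gapBound γ B R M) * (u ⬝ᵥ u) := by
  have hs := transpose_eq_of_posSemidef hM
  refine le_trans ?_ (dotProduct_mulVec_le_absSum _ u)
  have h := two_mul_dotProduct_sub_le hK (M *ᵥ (B *ᵥ u)) d
  rw [Matrix.sub_mulVec, Matrix.smul_mulVec, Matrix.one_mulVec, dotProduct_sub,
    dotProduct_smul, smul_eq_mul] at h
  have e : u ⬝ᵥ (gapBound γ B R M *ᵥ u) = u ⬝ᵥ (R *ᵥ u) + (B *ᵥ u) ⬝ᵥ (M *ᵥ (B *ᵥ u))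
      + (M *ᵥ (B *ᵥ u)) ⬝ᵥ ((γ ^ 2 • (1 : Matrix p p ℝ) - M)⁻¹ *ᵥ (M *ᵥ (B *ᵥ u))) := by
    have e1 : ∀ w : p → ℝ, u ⬝ᵥ (Bᵀ *ᵥ w) = (B *ᵥ u) ⬝ᵥ w := fun w => by
      rw [Matrix.dotProduct_mulVec, ← Matrix.mulVec_transpose, Matrix.transpose_transpose]
    have e2 : ∀ v w : p → ℝ, v ⬝ᵥ (M *ᵥ w) = (M *ᵥ v) ⬝ᵥ w := fun v w => by
      rw [dotProduct_mulVec_comm hs, dotProduct_comm]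
    rw [gapBound, Matrix.add_mulVec, Matrix.add_mulVec, dotProduct_add, dotProduct_add]
    simp only [← Matrix.mulVec_mulVec]
    rw [e1, e1, ← e2 (B *ᵥ u)]
  rw [e, gapForm, Matrix.mulVec_add, add_dotProduct, dotProduct_add, dotProduct_add,
    dotProduct_mulVec_comm hs (B *ᵥ u) d, dotProduct_comm d (M *ᵥ (B *ᵥ u))]
  linarith

/-- Completion of squares around a critical point `(l, k)` of the one-step cost-to-go, where `z` is
the next state reached from the critical point; the linear terms vanish by `hl` and `hk`. -/
theorem critical_point_expansion {γ : ℝ} {B : Matrix p q ℝ} {R : Matrix q q ℝ}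
    {M : Matrix p p ℝ} (hM : Mᵀ = M) (hR : Rᵀ = R) {y z k : p → ℝ} {l : q → ℝ}
    (hl : R *ᵥ l = -(Bᵀ *ᵥ (M *ᵥ z))) (hk : γ ^ 2 • k = M *ᵥ z) (hz : y + B *ᵥ l + k = z)
    (u : q → ℝ) (d : p → ℝ) :
    u ⬝ᵥ (R *ᵥ u) - γ ^ 2 * (d ⬝ᵥ d) + (y + B *ᵥ u + d) ⬝ᵥ (M *ᵥ (y + B *ᵥ u + d))
      = y ⬝ᵥ (M *ᵥ z) + gapForm γ B R M (u - l) (d - k) := by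
  obtain ⟨u, rfl⟩ : ∃ v, u = l + v := ⟨u - l, by abel⟩
  obtain ⟨d, rfl⟩ : ∃ v, d = k + v := ⟨d - k, by abel⟩
  have e0 : y + B *ᵥ (l + u) + (k + d) = z + (B *ᵥ u + d) := by
    rw [← hz, Matrix.mulVec_add]; abel
  have e1 : ∀ w : q → ℝ, w ⬝ᵥ (Bᵀ *ᵥ (M *ᵥ z)) = (B *ᵥ w) ⬝ᵥ (M *ᵥ z) := fun w => by
    rw [Matrix.dotProduct_mulVec, ← Matrix.mulVec_transpose, Matrix.transpose_transpose]
  have e2 : ∀ w : p → ℝ, γ ^ 2 * (w ⬝ᵥ k) = w ⬝ᵥ (M *ᵥ z) := fun w => by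
    rw [← hk, dotProduct_smul, smul_eq_mul]
  have e3 : y ⬝ᵥ (M *ᵥ z) = z ⬝ᵥ (M *ᵥ z) - (B *ᵥ l) ⬝ᵥ (M *ᵥ z) - k ⬝ᵥ (M *ᵥ z) := by
    have : y = z - B *ᵥ l - k := by rw [← hz]; abel
    rw [this, sub_dotProduct, sub_dotProduct]
  have a1 : l + u - l = u := by abel
  have a2 : k + d - k = d := by abel
  rw [e0, e3, a1, a2, gapForm]
  simp only [Matrix.mulVec_add R, Matrix.mulVec_add M z, add_dotProduct l u, dotProduct_add,
    add_dotProduct k d, add_dotProduct z, dotProduct_mulVec_comm hR l u, hl, dotProduct_neg, e1,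
    dotProduct_mulVec_comm hM z, dotProduct_comm k d, mul_add, e2]
  simp only [add_dotProduct, Matrix.mulVec_add, dotProduct_add]
  ring

section Recursion

variable [DecidableEq p] [DecidableEq q] {γ : ℝ} {T : ℕ} {A : ℕ → Matrix p p ℝ}
  {B : ℕ → Matrix p q ℝ} {Q : ℕ → Matrix p p ℝ}
  {R : ℕ → Matrix q q ℝ}

/-- The attenuation condition also holds at the last step, where the Riccati matrix vanishes. -/
theorem riccati_attenuation_extend (hγ : 0 < γ)
    (hK : ∀ t ∈ Finset.Icc 1 (T - 1),
      (γ ^ 2 • (1 : Matrix p p ℝ) - riccati γ T A B Q R (t + 1)).PosDef) :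
    ∀ t ∈ Finset.Icc 1 T, (γ ^ 2 • (1 : Matrix p p ℝ) - riccati γ T A B Q R (t + 1)).PosDef := by
  intro t ht
  rw [Finset.mem_Icc] at ht
  rcases ht.2.lt_or_eq with h | rfl
  · exact hK t (Finset.mem_Icc.2 (by omega))
  · rw [riccati_terminal, sub_zero]
    exact Matrix.PosDef.one.smul (by positivity)

theorem riccati_posSemidef (hγ : 0 < γ) (hQ : ∀ t ∈ Finset.Icc 1 T, (Q t).PosSemidef)
    (hR : ∀ t ∈ Finset.Icc 1 T, (R t).PosDef)
    (hK : ∀ t ∈ Finset.Icc 1 T,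
      (γ ^ 2 • (1 : Matrix p p ℝ) - riccati γ T A B Q R (t + 1)).PosDef) :
    ∀ t ∈ Finset.Icc 1 (T + 1), (riccati γ T A B Q R t).PosSemidef := by
  have key : ∀ k ≤ T, (riccati γ T A B Q R (T + 1 - k)).PosSemidef := by
    intro k
    induction k with
    | zero => intro _; rw [Nat.sub_zero, riccati_terminal]; exact Matrix.PosSemidef.zero
    | succ k ih =>
      intro hk
      have hmem : T - k ∈ Finset.Icc 1 T := Finset.mem_Icc.2 (by omega)
      have h1 : T + 1 - (k + 1) = T - k := by omega
      have h2 : T + 1 - k = T - k + 1 := by omega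
      have ih := ih (by omega)
      rw [h2] at ih
      rw [h1, riccati_step _ _ _ _ _ _ _ (by omega : T - k ≤ T)]
      refine (hQ _ hmem).add ?_
      have := (posSemidef_mul_delta_inv (B := B (T - k)) hγ ih (hK _ hmem)
        (hR _ hmem)).conjTranspose_mul_mul_same (A (T - k))
      rwa [Matrix.conjTranspose_eq_transpose_of_trivial, ← Matrix.mul_assoc] at this
  intro t ht
  rw [Finset.mem_Icc] at ht
  have := key (T + 1 - t) (by omega)
  rwa [show T + 1 - (T + 1 - t) = t by omega] at this

/-- One step of dynamic programming: the cost of time `t` plus the cost-to-go of the next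
(noiseless) state is the cost-to-go at time `t` plus the gap. -/
theorem stage_completion {t : ℕ} (ht : t ≤ T) (hγ : 0 < γ) (hR : (R t).PosDef)
    (hM : (riccati γ T A B Q R (t + 1)).PosSemidef)
    (hK : (γ ^ 2 • (1 : Matrix p p ℝ) - riccati γ T A B Q R (t + 1)).PosDef)
    (x : p → ℝ) (u : q → ℝ) (d : p → ℝ) :
    x ⬝ᵥ (Q t *ᵥ x) + u ⬝ᵥ (R t *ᵥ u) - γ ^ 2 * (d ⬝ᵥ d)
        + (A t *ᵥ x + B t *ᵥ u + d) ⬝ᵥ (riccati γ T A B Q R (t + 1) *ᵥ (A t *ᵥ x + B t *ᵥ u + d))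
      = x ⬝ᵥ (riccati γ T A B Q R t *ᵥ x)
        + gapForm γ (B t) (R t) (riccati γ T A B Q R (t + 1))
          (u - controlGain γ T A B Q R t *ᵥ x) (d - worstGain γ T A B Q R t *ᵥ x) := by
  have hu := isUnit_det_delta (B := B t) hγ hM hK hR
  have hstep := riccati_step γ T A B Q R t ht
  set M := riccati γ T A B Q R (t + 1) with hMdef
  -- `z` is the next state under the saddle-point action and disturbance.
  set z := (delta γ (B t) (R t) M)⁻¹ *ᵥ (A t *ᵥ x) with hz
  have hl : controlGain γ T A B Q R t *ᵥ x = -((R t)⁻¹ *ᵥ ((B t)ᵀ *ᵥ (M *ᵥ z))) := by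
    simp [controlGain, hz, ← hMdef, Matrix.neg_mulVec, Matrix.mulVec_mulVec, Matrix.mul_assoc]
  have hk : worstGain γ T A B Q R t *ᵥ x = (γ ^ 2)⁻¹ • (M *ᵥ z) := by
    simp [worstGain, hz, ← hMdef, Matrix.smul_mulVec, Matrix.mulVec_mulVec, Matrix.mul_assoc]
  have hdz : delta γ (B t) (R t) M *ᵥ z = A t *ᵥ x := by
    rw [hz, Matrix.mulVec_mulVec, Matrix.mul_nonsing_inv _ hu, Matrix.one_mulVec]
  have hcrit := critical_point_expansion (γ := γ) (B := B t) (R := R t)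
    (transpose_eq_of_posSemidef hM) (transpose_eq_of_posSemidef hR.posSemidef) (y := A t *ᵥ x)
    (z := z) (k := worstGain γ T A B Q R t *ᵥ x) (l := controlGain γ T A B Q R t *ᵥ x)
    (by rw [hl, Matrix.mulVec_neg, Matrix.mulVec_mulVec (M := R t),
          Matrix.mul_nonsing_inv _ (isUnit_det_of_posDef hR), Matrix.one_mulVec])
    (by rw [hk, smul_smul, mul_inv_cancel₀ (by positivity), one_smul])
    (by rw [← hdz, delta_mulVec, hl, hk, Matrix.mulVec_neg]; abel) u d
  have hx : x ⬝ᵥ (riccati γ T A B Q R t *ᵥ x) = x ⬝ᵥ (Q t *ᵥ x) + (A t *ᵥ x) ⬝ᵥ (M *ᵥ z) := by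
    rw [hstep, Matrix.add_mulVec, dotProduct_add, hz]
    simp only [← Matrix.mulVec_mulVec]
    rw [Matrix.dotProduct_mulVec x (A t)ᵀ, ← Matrix.mulVec_transpose, Matrix.transpose_transpose]
  rw [hx]
  linarith

end Recursion

end Game

/-! ### Deviations from the mean-field and the (leader, mean-field) pair -/

namespace Profile

variable {n ℓ : ℕ}

/-- The mean-field as a continuous linear map. -/
def aggMap (n ℓ : ℕ) : Profile n ℓ →L[ℝ] (Fin ℓ → ℝ) :=
  (n : ℝ)⁻¹ • ∑ i : Fin n, ContinuousLinearMap.proj (some i)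

theorem aggMap_apply (p : Profile n ℓ) : aggMap n ℓ p = p.agg := by
  simp [aggMap, agg]

/-- The deviation of follower `i` from the mean-field. -/
def dev (i : Fin n) : Profile n ℓ →L[ℝ] (Fin ℓ → ℝ) :=
  ContinuousLinearMap.proj (some i) - aggMap n ℓ

/-- The pair (leader, mean-field) as a single vector, indexed as the matrices `Model.Abar` etc. -/
def bar : Profile n ℓ →L[ℝ] (Fin ℓ ⊕ Fin ℓ → ℝ) :=
  LinearMap.toContinuousLinearMap
    { toFun := fun p => Sum.elim (p none) (aggMap n ℓ p)
      map_add' := fun p r => by rw [map_add]; funext a; rcases a with a | a <;> rfl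
      map_smul' := fun c p => by rw [map_smul]; funext a; rcases a with a | a <;> rfl }

theorem dev_apply (i : Fin n) (p : Profile n ℓ) : dev i p = p (some i) - p.agg := by
  simp [dev, aggMap_apply]

theorem bar_apply (p : Profile n ℓ) : bar p = Sum.elim (p none) p.agg := by
  simp [bar, aggMap_apply]

theorem some_eq_dev_add_agg (p : Profile n ℓ) (i : Fin n) : p (some i) = dev i p + p.agg := by
  rw [dev_apply, sub_add_cancel]

theorem card_smul_agg (hn : 0 < n) (p : Profile n ℓ) :
    (n : ℝ) • p.agg = ∑ i : Fin n, p (some i) := by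
  rw [agg, smul_smul, mul_inv_cancel₀ (by positivity), one_smul]

theorem sum_dev (hn : 0 < n) (p : Profile n ℓ) : ∑ i : Fin n, dev i p = 0 := by
  simp only [dev_apply, Finset.sum_sub_distrib, Finset.sum_const, Finset.card_univ,
    Fintype.card_fin, ← Nat.cast_smul_eq_nsmul ℝ, card_smul_agg hn, sub_self]

/-- Vectors `v i + c` with `∑ i, v i = 0` have mean `c`: a convenient way to compute mean-fields. -/
theorem agg_eq_of_sum (hn : 0 < n) {p : Profile n ℓ} {v : Fin n → Fin ℓ → ℝ} {c : Fin ℓ → ℝ}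
    (hp : ∀ i, p (some i) = v i + c) (hv : ∑ i, v i = 0) : p.agg = c := by
  simp only [agg, hp, Finset.sum_add_distrib, hv, Finset.sum_const, Finset.card_univ,
    Fintype.card_fin, ← Nat.cast_smul_eq_nsmul ℝ, zero_add]
  rw [smul_smul, inv_mul_cancel₀ (by positivity), one_smul]

theorem sum_mulVec_dev {ℓ' : ℕ} (hn : 0 < n) (K : Matrix (Fin ℓ') (Fin ℓ) ℝ) (p : Profile n ℓ) :
    ∑ i : Fin n, K *ᵥ dev i p = 0 := by
  rw [← Matrix.mulVec_sum, sum_dev hn, Matrix.mulVec_zero]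

/-- Steiner's identity: an average of squares is the average of the squared deviations plus the
square of the mean. -/
theorem mean_quad (hn : 0 < n) (K : Matrix (Fin ℓ) (Fin ℓ) ℝ) (p : Profile n ℓ) :
    (n : ℝ)⁻¹ * ∑ i : Fin n, p (some i) ⬝ᵥ (K *ᵥ p (some i))
      = (n : ℝ)⁻¹ * ∑ i : Fin n, dev i p ⬝ᵥ (K *ᵥ dev i p) + p.agg ⬝ᵥ (K *ᵥ p.agg) := by
  have h1 : ∀ i : Fin n, p (some i) ⬝ᵥ (K *ᵥ p (some i)) = dev i p ⬝ᵥ (K *ᵥ dev i p)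
      + dev i p ⬝ᵥ (K *ᵥ p.agg) + p.agg ⬝ᵥ (K *ᵥ dev i p) + p.agg ⬝ᵥ (K *ᵥ p.agg) := fun i => by
    rw [some_eq_dev_add_agg p i, Matrix.mulVec_add, add_dotProduct, dotProduct_add,
      dotProduct_add]
    ring
  have h2 : ∑ i : Fin n, dev i p ⬝ᵥ (K *ᵥ p.agg) = 0 := by
    rw [← sum_dotProduct, sum_dev hn, zero_dotProduct]
  have h3 : ∑ i : Fin n, p.agg ⬝ᵥ (K *ᵥ dev i p) = 0 := by
    rw [← dotProduct_sum, sum_mulVec_dev hn, dotProduct_zero]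
  have hn' : (n : ℝ) ≠ 0 := by positivity
  simp only [h1, Finset.sum_add_distrib, h2, h3, Finset.sum_const, Finset.card_univ,
    Fintype.card_fin, nsmul_eq_mul, add_zero]
  field_simp

/-- The bilinear form on profiles given by `K` on the deviations, averaged over the followers, and
by `Kb` on the pair (leader, mean-field). Stage costs and value functions are of this form. -/
def pairing (K : Matrix (Fin ℓ) (Fin ℓ) ℝ) (Kb : Matrix (Fin ℓ ⊕ Fin ℓ) (Fin ℓ ⊕ Fin ℓ) ℝ)
    (p r : Profile n ℓ) : ℝ :=
  (n : ℝ)⁻¹ * ∑ i : Fin n, dev i p ⬝ᵥ (K *ᵥ dev i r) + bar p ⬝ᵥ (Kb *ᵥ bar r)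

variable {K : Matrix (Fin ℓ) (Fin ℓ) ℝ} {Kb : Matrix (Fin ℓ ⊕ Fin ℓ) (Fin ℓ ⊕ Fin ℓ) ℝ}

theorem pairing_self_nonneg (hK : K.PosSemidef) (hKb : Kb.PosSemidef) (p : Profile n ℓ) :
    0 ≤ pairing K Kb p p :=
  add_nonneg (mul_nonneg (by positivity)
    (Finset.sum_nonneg fun _ _ => dotProduct_mulVec_nonneg hK _)) (dotProduct_mulVec_nonneg hKb _)

theorem pairing_add_self (hK : Kᵀ = K) (hKb : Kbᵀ = Kb) (p r : Profile n ℓ) :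
    pairing K Kb (p + r) (p + r)
      = pairing K Kb p p + pairing K Kb r r + 2 * pairing K Kb p r := by
  have h1 : ∀ i : Fin n, dev i (p + r) ⬝ᵥ (K *ᵥ dev i (p + r)) = dev i p ⬝ᵥ (K *ᵥ dev i p)
      + dev i r ⬝ᵥ (K *ᵥ dev i r) + 2 * (dev i p ⬝ᵥ (K *ᵥ dev i r)) := fun i => by
    rw [map_add, Matrix.mulVec_add, add_dotProduct, dotProduct_add, dotProduct_add,
      dotProduct_mulVec_comm hK (dev i r) (dev i p)]
    ring
  have h2 : bar (p + r) ⬝ᵥ (Kb *ᵥ bar (p + r)) = bar p ⬝ᵥ (Kb *ᵥ bar p)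
      + bar r ⬝ᵥ (Kb *ᵥ bar r) + 2 * (bar p ⬝ᵥ (Kb *ᵥ bar r)) := by
    rw [map_add, Matrix.mulVec_add, add_dotProduct, dotProduct_add, dotProduct_add,
      dotProduct_mulVec_comm hKb (bar r) (bar p)]
    ring
  simp only [pairing, h1, h2, Finset.sum_add_distrib, ← Finset.mul_sum]
  ring

end Profile

open Profile

namespace Model

variable {ℓx ℓu : ℕ} (M : Model ℓx ℓu) {n : ℕ}

/-! ### Decoupling of the dynamics and of the cost -/

theorem agg_step (hn : 0 < n) (t : ℕ) (x : Profile n ℓx) (u : Profile n ℓu)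
    (d w : Profile n ℓx) : (M.step t x u d w).agg = M.A t *ᵥ x.agg + M.B t *ᵥ u.agg
      + M.S t *ᵥ x.agg + M.E t *ᵥ x none + d.agg + w.agg := by
  refine agg_eq_of_sum hn
    (v := fun i => M.A t *ᵥ dev i x + M.B t *ᵥ dev i u + dev i d + dev i w) (fun i => ?_) ?_
  · simp only [step, some_eq_dev_add_agg x i, some_eq_dev_add_agg u i,
      some_eq_dev_add_agg d i, some_eq_dev_add_agg w i, Matrix.mulVec_add]
    abel
  · simp only [Finset.sum_add_distrib, sum_mulVec_dev hn, sum_dev hn, add_zero]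

theorem dev_step (hn : 0 < n) (t : ℕ) (x : Profile n ℓx) (u : Profile n ℓu) (d w : Profile n ℓx)
    (i : Fin n) : dev i (M.step t x u d w)
      = M.A t *ᵥ dev i x + M.B t *ᵥ dev i u + dev i d + dev i w := by
  rw [dev_apply, M.agg_step hn]
  simp only [step, dev_apply, Matrix.mulVec_sub]
  abel

theorem bar_step (hn : 0 < n) (t : ℕ) (x : Profile n ℓx) (u : Profile n ℓu)
    (d w : Profile n ℓx) : bar (M.step t x u d w)
      = M.Abar t *ᵥ bar x + M.Bbar t *ᵥ bar u + bar d + bar w := by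
  simp only [bar_apply, M.agg_step hn, Abar, Bbar, Matrix.fromBlocks_mulVec]
  funext a
  rcases a with a | a
  · simp [step]; ring
  · simp [Matrix.add_mulVec]; ring

/-- The cost of one stage is the sum of a cost of the deviations and of a cost of the pair
(leader, mean-field). -/
theorem stageCost_eq (hn : 0 < n) (γ : ℝ) (t : ℕ) (x : Profile n ℓx) (u : Profile n ℓu)
    (d : Profile n ℓx) : M.stageCost γ t x u d = pairing (M.Q t) (M.Qbar t) x x
      + pairing (M.R t) (M.Rbar t) u u - γ ^ 2 * pairing 1 1 d d := by
  have hx := mean_quad hn (M.Q t) x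
  have hu := mean_quad hn (M.R t) u
  have hd := mean_quad hn 1 d
  simp only [Matrix.one_mulVec] at hd
  have e : (n : ℝ)⁻¹ * ∑ i : Fin n, (quad (M.Q t) (x (some i)) + quad (M.R t) (u (some i))
      - γ ^ 2 * (d (some i) ⬝ᵥ d (some i)))
      = (n : ℝ)⁻¹ * ∑ i : Fin n, x (some i) ⬝ᵥ (M.Q t *ᵥ x (some i))
        + (n : ℝ)⁻¹ * ∑ i : Fin n, u (some i) ⬝ᵥ (M.R t *ᵥ u (some i))
        - γ ^ 2 * ((n : ℝ)⁻¹ * ∑ i : Fin n, d (some i) ⬝ᵥ d (some i)) := by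
    simp only [quad, Finset.sum_sub_distrib, Finset.sum_add_distrib, ← Finset.mul_sum]
    ring
  rw [stageCost, e, hx, hu, hd]
  simp only [pairing, bar_apply, Qbar, Rbar, Matrix.fromBlocks_mulVec, Matrix.one_mulVec, quad,
    Sum.elim_comp_inl, Sum.elim_comp_inr, sumElim_dotProduct_sumElim, Matrix.add_mulVec,
    Matrix.neg_mulVec, Matrix.zero_mulVec, Matrix.mulVec_sub, dotProduct_add, dotProduct_sub,
    sub_dotProduct, dotProduct_neg, add_zero, zero_add]
  ring

/-- The value function of the game with `n` followers at time `t`, up to the contribution of the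
noise, which does not depend on the state. -/
def costToGo (γ : ℝ) (T t : ℕ) (x : Profile n ℓx) : ℝ :=
  pairing (M.Mdev γ T t) (M.Mbar γ T t) x x

/-- The excess cost of time `t` when the actions `u` and the disturbance `d` differ from the
saddle point at the state `x`. -/
def gap (γ : ℝ) (T t : ℕ) (x : Profile n ℓx) (u : Profile n ℓu) (d : Profile n ℓx) : ℝ :=
  (n : ℝ)⁻¹ * ∑ i : Fin n, gapForm γ (M.B t) (M.R t) (M.Mdev γ T (t + 1))
      (dev i u - M.Ldev γ T t *ᵥ dev i x)
      (dev i d - worstGain γ T M.A M.B M.Q M.R t *ᵥ dev i x)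
    + gapForm γ (M.Bbar t) (M.Rbar t) (M.Mbar γ T (t + 1))
      (bar u - M.Lbar γ T t *ᵥ bar x)
      (bar d - worstGain γ T M.Abar M.Bbar M.Qbar M.Rbar t *ᵥ bar x)

/-- The definiteness properties at time `t` which make the one-step game have a saddle point, in
both subsystems. Unlike in `Model.Convexity` and `Model.Attenuation`, those of the Riccati matrices
of time `t + 1` are included up to `t = T`. -/
structure Regular (γ : ℝ) (T t : ℕ) : Prop where
  R_pd : (M.R t).PosDef
  Rbar_pd : (M.Rbar t).PosDef
  Q_psd : (M.Q t).PosSemidef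
  Qbar_psd : (M.Qbar t).PosSemidef
  dev_psd : (M.Mdev γ T (t + 1)).PosSemidef
  bar_psd : (M.Mbar γ T (t + 1)).PosSemidef
  dev_pd : (γ ^ 2 • (1 : Matrix (Fin ℓx) (Fin ℓx) ℝ) - M.Mdev γ T (t + 1)).PosDef
  bar_pd : (γ ^ 2 • (1 : Matrix (Fin ℓx ⊕ Fin ℓx) (Fin ℓx ⊕ Fin ℓx) ℝ)
    - M.Mbar γ T (t + 1)).PosDef

variable {M}

theorem regular {γ : ℝ} {T : ℕ} (hγ : 0 < γ) (hconv : M.Convexity T) (hatt : M.Attenuation γ T)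
    {t : ℕ} (ht : t ∈ Finset.Icc 1 T) : M.Regular γ T t := by
  have h1 := riccati_attenuation_extend hγ hatt.dev_pd
  have h2 := riccati_attenuation_extend hγ hatt.bar_pd
  have ht' : t + 1 ∈ Finset.Icc 1 (T + 1) := by
    rw [Finset.mem_Icc] at ht ⊢; omega
  exact ⟨hconv.R_pd t ht, hconv.Rbar_pd t ht, hconv.Q_psd t ht, hconv.Qbar_psd t ht,
    riccati_posSemidef hγ hconv.Q_psd hconv.R_pd h1 _ ht',
    riccati_posSemidef hγ hconv.Qbar_psd hconv.Rbar_pd h2 _ ht', h1 t ht, h2 t ht⟩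

theorem costToGo_terminal (γ : ℝ) (T : ℕ) (x : Profile n ℓx) : M.costToGo γ T (T + 1) x = 0 := by
  simp [costToGo, pairing, Mdev, Mbar, riccati_terminal]

theorem step_eq_add_noise (t : ℕ) (x : Profile n ℓx) (u : Profile n ℓu) (d w : Profile n ℓx) :
    M.step t x u d w = M.step t x u d 0 + w := by
  funext k
  rcases k with _ | i <;> simp [step]

/-- One step of dynamic programming for the whole population. -/
theorem stageCost_add_costToGo {γ : ℝ} {T t : ℕ} (hγ : 0 < γ) (hn : 0 < n) (ht : t ≤ T)
    (hr : M.Regular γ T t) (x : Profile n ℓx) (u : Profile n ℓu) (d w : Profile n ℓx) :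
    M.stageCost γ t x u d + M.costToGo γ T (t + 1) (M.step t x u d w)
      = M.costToGo γ T t x + M.gap γ T t x u d + M.costToGo γ T (t + 1) w
        + 2 * pairing (M.Mdev γ T (t + 1)) (M.Mbar γ T (t + 1)) (M.step t x u d 0) w := by
  rw [step_eq_add_noise, costToGo, pairing_add_self (transpose_eq_of_posSemidef hr.dev_psd)
    (transpose_eq_of_posSemidef hr.bar_psd), M.stageCost_eq hn]
  have hdev := fun i : Fin n => stage_completion (A := M.A) (B := M.B) (Q := M.Q) (R := M.R)
    ht hγ hr.R_pd hr.dev_psd hr.dev_pd (dev i x) (dev i u) (dev i d)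
  have hbar := stage_completion (A := M.Abar) (B := M.Bbar) (Q := M.Qbar) (R := M.Rbar)
    ht hγ hr.Rbar_pd hr.bar_psd hr.bar_pd (bar x) (bar u) (bar d)
  have hsum := congrArg (fun r => (n : ℝ)⁻¹ * r)
    (Finset.sum_congr (rfl : (Finset.univ : Finset (Fin n)) = _) fun i _ => hdev i)
  simp only [Finset.sum_add_distrib, Finset.sum_sub_distrib, ← Finset.mul_sum] at hsum
  have h1 : pairing (M.Mdev γ T (t + 1)) (M.Mbar γ T (t + 1)) (M.step t x u d 0)
      (M.step t x u d 0) = (n : ℝ)⁻¹ * ∑ i : Fin n,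
        (M.A t *ᵥ dev i x + M.B t *ᵥ dev i u + dev i d) ⬝ᵥ (M.Mdev γ T (t + 1) *ᵥ
          (M.A t *ᵥ dev i x + M.B t *ᵥ dev i u + dev i d))
      + (M.Abar t *ᵥ bar x + M.Bbar t *ᵥ bar u + bar d) ⬝ᵥ (M.Mbar γ T (t + 1) *ᵥ
          (M.Abar t *ᵥ bar x + M.Bbar t *ᵥ bar u + bar d)) := by
    simp only [pairing, M.dev_step hn, M.bar_step hn, map_zero, add_zero]
  rw [h1]
  simp only [pairing, costToGo, gap, Matrix.one_mulVec, Mdev, Mbar, Ldev, Lbar] at *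
  linarith

/-- Against the worst-case disturbance every action costs at least the saddle value. -/
theorem gap_nonneg {γ : ℝ} {T t : ℕ} (hr : M.Regular γ T t) {x : Profile n ℓx} {u : Profile n ℓu}
    {d : Profile n ℓx} (h1 : ∀ i, dev i d = worstGain γ T M.A M.B M.Q M.R t *ᵥ dev i x)
    (h2 : bar d = worstGain γ T M.Abar M.Bbar M.Qbar M.Rbar t *ᵥ bar x) :
    0 ≤ M.gap γ T t x u d := by
  simp only [gap, h1, h2, sub_self]
  exact add_nonneg (mul_nonneg (by positivity) (Finset.sum_nonneg fun _ _ =>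
    gapForm_nonneg hr.dev_psd hr.R_pd.posSemidef _))
    (gapForm_nonneg hr.bar_psd hr.Rbar_pd.posSemidef _)

/-- If the deviations are controlled optimally, the gap is at most a multiple of the squared error
of the control of the pair (leader, mean-field), whatever the disturbance. -/
theorem gap_le {γ : ℝ} {T t : ℕ} (hr : M.Regular γ T t) {x : Profile n ℓx} {u : Profile n ℓu}
    (h1 : ∀ i, dev i u = M.Ldev γ T t *ᵥ dev i x) (d : Profile n ℓx) :
    M.gap γ T t x u d ≤ absSum (gapBound γ (M.Bbar t) (M.Rbar t) (M.Mbar γ T (t + 1)))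
      * ((bar u - M.Lbar γ T t *ᵥ bar x) ⬝ᵥ (bar u - M.Lbar γ T t *ᵥ bar x)) := by
  have h : (n : ℝ)⁻¹ * ∑ i : Fin n, gapForm γ (M.B t) (M.R t) (M.Mdev γ T (t + 1))
      (dev i u - M.Ldev γ T t *ᵥ dev i x)
      (dev i d - worstGain γ T M.A M.B M.Q M.R t *ᵥ dev i x) ≤ 0 := by
    simp only [h1, sub_self]
    exact mul_nonpos_of_nonneg_of_nonpos (by positivity)
      (Finset.sum_nonpos fun _ _ => gapForm_nonpos hr.dev_pd _)
  have h' := gapForm_le (B := M.Bbar t) (R := M.Rbar t) hr.bar_psd hr.bar_pd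
    (bar u - M.Lbar γ T t *ᵥ bar x)
    (bar d - worstGain γ T M.Abar M.Bbar M.Qbar M.Rbar t *ᵥ bar x)
  unfold gap
  linarith

/-! ### The saddle-point gains acting on profiles -/

theorem agg_worst (hn : 0 < n) (γ : ℝ) (T t : ℕ) (x : Profile n ℓx) :
    (M.worst γ T t x).agg = M.worstAgg γ T t (x none) x.agg :=
  agg_eq_of_sum hn (v := fun i => worstGain γ T M.A M.B M.Q M.R t *ᵥ dev i x)
    (fun i => by simp only [worst, dev_apply]) (sum_mulVec_dev hn _ _)

theorem dev_worst (hn : 0 < n) (γ : ℝ) (T t : ℕ) (x : Profile n ℓx) (i : Fin n) :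
    dev i (M.worst γ T t x) = worstGain γ T M.A M.B M.Q M.R t *ᵥ dev i x := by
  rw [dev_apply, agg_worst hn, dev_apply]
  simp [worst]

theorem bar_worst (hn : 0 < n) (γ : ℝ) (T t : ℕ) (x : Profile n ℓx) :
    bar (M.worst γ T t x) = worstGain γ T M.Abar M.Bbar M.Qbar M.Rbar t *ᵥ bar x := by
  rw [bar_apply, bar_apply, agg_worst hn]
  funext a
  rcases a with a | a <;> simp [worst, worstAgg, worstBar]

theorem agg_approxAction (hn : 0 < n) (γ : ℝ) (T t : ℕ) (x : Profile n ℓx) (mhat : Fin ℓx → ℝ) :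
    (M.approxAction γ T t x mhat).agg = M.Ldev γ T t *ᵥ x.agg
      + (M.Lbar γ T t).toBlocks₂₁ *ᵥ x none
      + ((M.Lbar γ T t).toBlocks₂₂ - M.Ldev γ T t) *ᵥ mhat := by
  refine agg_eq_of_sum hn (v := fun i => M.Ldev γ T t *ᵥ dev i x) (fun i => ?_)
    (sum_mulVec_dev hn _ _)
  simp only [approxAction, some_eq_dev_add_agg x i, Matrix.mulVec_add]
  abel

theorem dev_approxAction (hn : 0 < n) (γ : ℝ) (T t : ℕ) (x : Profile n ℓx) (mhat : Fin ℓx → ℝ)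
    (i : Fin n) : dev i (M.approxAction γ T t x mhat) = M.Ldev γ T t *ᵥ dev i x := by
  rw [dev_apply, agg_approxAction hn, dev_apply, Matrix.mulVec_sub]
  simp only [approxAction]
  abel

/-- The gain through which an error in the estimate of the mean-field enters the pair
(leader's action, average action). -/
def errGain (M : Model ℓx ℓu) (γ : ℝ) (T t : ℕ) : Matrix (Fin ℓu ⊕ Fin ℓu) (Fin ℓx) ℝ :=
  Matrix.fromRows (M.Lbar γ T t).toBlocks₁₂ ((M.Lbar γ T t).toBlocks₂₂ - M.Ldev γ T t)

theorem bar_approxAction (hn : 0 < n) (γ : ℝ) (T t : ℕ) (x : Profile n ℓx)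
    (mhat : Fin ℓx → ℝ) : bar (M.approxAction γ T t x mhat) - M.Lbar γ T t *ᵥ bar x
      = M.errGain γ T t *ᵥ (mhat - x.agg) := by
  rw [bar_apply, bar_apply, agg_approxAction hn, errGain, Matrix.fromRows_mulVec,
    ← Matrix.fromBlocks_toBlocks (M.Lbar γ T t), Matrix.fromBlocks_mulVec]
  funext a
  rcases a with a | a
  · simp [approxAction, Matrix.mulVec_sub]
  · simp [Matrix.mulVec_sub, Matrix.sub_mulVec]
    ring

/-- Between observations the estimation error evolves autonomously, up to the error
`dbar - d.agg` made on the aggregate disturbance: the gain `Lbar` enters the estimate and the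
mean-field alike and cancels. -/
theorem nextEstimate_none_sub_agg (hn : 0 < n) (γ : ℝ) (T t : ℕ) (x : Profile n ℓx)
    (mhat dbar : Fin ℓx → ℝ) (d w : Profile n ℓx) :
    M.nextEstimate γ T t mhat (x none) dbar none
        - (M.step t x (M.approxAction γ T t x mhat) d w).agg
      = (M.A t + M.S t + M.B t * M.Ldev γ T t) *ᵥ (mhat - x.agg) + (dbar - d.agg) - w.agg := by
  rw [M.agg_step hn, agg_approxAction hn]
  simp only [nextEstimate, Matrix.add_mulVec, Matrix.sub_mulVec, Matrix.mulVec_add,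
    Matrix.mulVec_sub, ← Matrix.mulVec_mulVec]
  abel

end Model

/-! ### Square integrable random vectors and quadratic forms -/

section SquareIntegrable

variable {Ω : Type*} [MeasurableSpace Ω] {μ : Measure Ω} {ι κ : Type} [Fintype ι] [Fintype κ]

theorem memLp_mulVec (K : Matrix ι κ ℝ) {X : Ω → κ → ℝ} (hX : MemLp X 2 μ) :
    MemLp (fun ω => K *ᵥ X ω) 2 μ :=
  (LinearMap.toContinuousLinearMap (Matrix.mulVecLin K)).comp_memLp' hX

theorem integrable_dotProduct {X Y : Ω → ι → ℝ} (hX : MemLp X 2 μ) (hY : MemLp Y 2 μ) :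
    Integrable (fun ω => X ω ⬝ᵥ Y ω) μ :=
  integrable_finsetSum _ fun i _ => (hX.eval i).integrable_mul (hY.eval i)

theorem memLp_two_of_integrable_dotProduct_self {X : Ω → ι → ℝ} (hX : Measurable X)
    (h : Integrable (fun ω => X ω ⬝ᵥ X ω) μ) : MemLp X 2 μ := by
  refine MemLp.of_eval fun i => ?_
  have hm : Measurable fun ω => X ω i := (measurable_pi_apply i).comp hX
  rw [memLp_two_iff_integrable_sq hm.aestronglyMeasurable]
  refine h.mono' (hm.pow_const 2).aestronglyMeasurable (ae_of_all _ fun ω => ?_)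
  rw [Real.norm_eq_abs, abs_of_nonneg (sq_nonneg _), sq]
  exact mul_self_le_dotProduct_self _ _

theorem integrable_gapForm {ι κ : Type} [Fintype ι] [Fintype κ] (γ : ℝ) (B : Matrix ι κ ℝ)
    (R : Matrix κ κ ℝ) (K : Matrix ι ι ℝ) {U : Ω → κ → ℝ} {D : Ω → ι → ℝ} (hU : MemLp U 2 μ)
    (hD : MemLp D 2 μ) : Integrable (fun ω => gapForm γ B R K (U ω) (D ω)) μ := by
  have hy : MemLp (fun ω => B *ᵥ U ω + D ω) 2 μ := (memLp_mulVec B hU).add hD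
  exact ((integrable_dotProduct hU (memLp_mulVec R hU)).sub
    ((integrable_dotProduct hD hD).const_mul _)).add
    (integrable_dotProduct hy (memLp_mulVec K hy))

variable {n ℓ : ℕ}

theorem integrable_pairing (K : Matrix (Fin ℓ) (Fin ℓ) ℝ)
    (Kb : Matrix (Fin ℓ ⊕ Fin ℓ) (Fin ℓ ⊕ Fin ℓ) ℝ) {X Y : Ω → Profile n ℓ} (hX : MemLp X 2 μ)
    (hY : MemLp Y 2 μ) : Integrable (fun ω => pairing K Kb (X ω) (Y ω)) μ := by
  refine ((integrable_finsetSum _ fun i _ => ?_).const_mul _).add ?_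
  · exact integrable_dotProduct ((dev i).comp_memLp' hX)
      (memLp_mulVec K ((dev i).comp_memLp' hY))
  · exact integrable_dotProduct (bar.comp_memLp' hX) (memLp_mulVec Kb (bar.comp_memLp' hY))

namespace Model

variable {ℓx ℓu : ℕ} (M : Model ℓx ℓu)

theorem integrable_stageCost (hn : 0 < n) (γ : ℝ) (t : ℕ) {X D : Ω → Profile n ℓx}
    {U : Ω → Profile n ℓu} (hX : MemLp X 2 μ) (hU : MemLp U 2 μ) (hD : MemLp D 2 μ) :
    Integrable (fun ω => M.stageCost γ t (X ω) (U ω) (D ω)) μ := by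
  simp only [M.stageCost_eq hn]
  exact ((integrable_pairing _ _ hX hX).add (integrable_pairing _ _ hU hU)).sub
    ((integrable_pairing _ _ hD hD).const_mul _)

theorem integrable_gap (γ : ℝ) (T t : ℕ) {X D : Ω → Profile n ℓx}
    {U : Ω → Profile n ℓu} (hX : MemLp X 2 μ) (hU : MemLp U 2 μ) (hD : MemLp D 2 μ) :
    Integrable (fun ω => M.gap γ T t (X ω) (U ω) (D ω)) μ := by
  refine ((integrable_finsetSum _ fun i _ => ?_).const_mul _).add ?_
  · exact integrable_gapForm γ _ _ _
      (((dev i).comp_memLp' hU).sub (memLp_mulVec _ ((dev i).comp_memLp' hX)))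
      (((dev i).comp_memLp' hD).sub (memLp_mulVec _ ((dev i).comp_memLp' hX)))
  · exact integrable_gapForm γ _ _ _
      ((bar.comp_memLp' hU).sub (memLp_mulVec _ (bar.comp_memLp' hX)))
      ((bar.comp_memLp' hD).sub (memLp_mulVec _ (bar.comp_memLp' hX)))

end Model

end SquareIntegrable

/-! ### Non-anticipative random vectors -/

section Known

variable {n ℓx ℓu : ℕ} {Ω : Type*} [MeasurableSpace Ω]

/-- `X` is square integrable and measurable with respect to the initial states and the noises
before time `t`. -/
structure Known (N : Primitives n ℓx Ω) (μ : Measure Ω) (t : ℕ) {E : Type*}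
    [NormedAddCommGroup E] [MeasurableSpace E] (X : Ω → E) : Prop where
  adapted : Measurable[N.past t] X
  memLp : MemLp X 2 μ

omit [MeasurableSpace Ω] in
theorem Primitives.past_mono (N : Primitives n ℓx Ω) {s t : ℕ} (h : s ≤ t) :
    N.past s ≤ N.past t :=
  iSup_le fun r => iSup_le fun hr => le_iSup₂_of_le r (hr.trans_le h) le_rfl

namespace Known

variable {N : Primitives n ℓx Ω} {μ : Measure Ω} {t : ℕ}

theorem mono {E : Type*} [NormedAddCommGroup E] [MeasurableSpace E] {X : Ω → E} {s : ℕ}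
    (h : Known N μ s X) (hst : s ≤ t) : Known N μ t X :=
  ⟨h.adapted.mono (N.past_mono hst) le_rfl, h.memLp⟩

theorem const [IsFiniteMeasure μ] {E : Type*} [NormedAddCommGroup E] [MeasurableSpace E] (c : E) :
    Known N μ t (fun _ => c) :=
  ⟨measurable_const, memLp_const c⟩

variable {E F : Type*} [NormedAddCommGroup E] [MeasurableSpace E]

theorem add [BorelSpace E] [SecondCountableTopology E] {X Y : Ω → E}
    (hX : Known N μ t X) (hY : Known N μ t Y) :
    Known N μ t (fun ω => X ω + Y ω) :=
  ⟨hX.adapted.add hY.adapted, hX.memLp.add hY.memLp⟩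

theorem clm [NormedSpace ℝ E] [BorelSpace E] [NormedAddCommGroup F] [NormedSpace ℝ F]
    [MeasurableSpace F] [BorelSpace F] (L : E →L[ℝ] F) {X : Ω → E} (hX : Known N μ t X) :
    Known N μ t (fun ω => L (X ω)) :=
  ⟨L.continuous.measurable.comp hX.adapted, L.comp_memLp' hX.memLp⟩

theorem mulVec {ι κ : Type} [Fintype ι] [Fintype κ] (K : Matrix ι κ ℝ) {X : Ω → κ → ℝ}
    (hX : Known N μ t X) : Known N μ t (fun ω => K *ᵥ X ω) :=
  hX.clm (LinearMap.toContinuousLinearMap (Matrix.mulVecLin K))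

theorem eval {ι : Type} [Fintype ι] {X : Ω → ι → E} (hX : Known N μ t X) (i : ι) :
    Known N μ t (fun ω => X ω i) :=
  ⟨(measurable_pi_apply i).comp hX.adapted, hX.memLp.eval i⟩

theorem of_eval {ι : Type} [Fintype ι] {X : Ω → ι → E} (h : ∀ i, Known N μ t (fun ω => X ω i)) :
    Known N μ t X :=
  ⟨@measurable_pi_lambda _ _ _ (N.past t) _ _ fun i => (h i).adapted,
    MemLp.of_eval fun i => (h i).memLp⟩

theorem agg {ℓ : ℕ} {X : Ω → Profile n ℓ} (hX : Known N μ t X) :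
    Known N μ t (fun ω => (X ω).agg) := by
  simpa only [aggMap_apply] using hX.clm (aggMap n ℓ)

theorem step (M : Model ℓx ℓu) (r : ℕ) {X D W : Ω → Profile n ℓx} {U : Ω → Profile n ℓu}
    (hX : Known N μ t X) (hU : Known N μ t U) (hD : Known N μ t D) (hW : Known N μ t W) :
    Known N μ t (fun ω => M.step r (X ω) (U ω) (D ω) (W ω)) := by
  refine of_eval fun k => ?_
  rcases k with _ | i
  · exact (((((hX.eval none).mulVec _).add ((hU.eval none).mulVec _)).add (hX.agg.mulVec _)).add
      (hD.eval none)).add (hW.eval none)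
  · exact ((((((hX.eval (some i)).mulVec _).add ((hU.eval (some i)).mulVec _)).add
      (hX.agg.mulVec _)).add ((hX.eval none).mulVec _)).add (hD.eval (some i))).add
      (hW.eval (some i))

theorem approxAction (M : Model ℓx ℓu) (γ : ℝ) (T r : ℕ) {X : Ω → Profile n ℓx}
    {Y : Ω → Fin ℓx → ℝ} (hX : Known N μ t X) (hY : Known N μ t Y) :
    Known N μ t (fun ω => M.approxAction γ T r (X ω) (Y ω)) := by
  refine of_eval fun k => ?_
  rcases k with _ | i
  · exact ((hX.eval none).mulVec _).add (hY.mulVec _)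
  · exact (((hX.eval (some i)).mulVec _).add ((hX.eval none).mulVec _)).add (hY.mulVec _)

theorem worstAgg (M : Model ℓx ℓu) (γ : ℝ) (T r : ℕ) {X Y : Ω → Fin ℓx → ℝ}
    (hX : Known N μ t X) (hY : Known N μ t Y) :
    Known N μ t (fun ω => M.worstAgg γ T r (X ω) (Y ω)) := by
  have h : Known N μ t (fun ω => (Sum.elim (X ω) (Y ω) : Fin ℓx ⊕ Fin ℓx → ℝ)) := by
    refine of_eval fun k => ?_
    rcases k with a | a
    · exact hX.eval a
    · exact hY.eval a
  exact of_eval fun a => (h.mulVec _).eval (Sum.inr a)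

theorem worst (M : Model ℓx ℓu) (γ : ℝ) (T r : ℕ) {X : Ω → Profile n ℓx}
    (hX : Known N μ t X) : Known N μ t (fun ω => M.worst γ T r (X ω)) := by
  refine of_eval fun k => ?_
  rcases k with _ | i
  · refine of_eval fun a => ?_
    have h := ((hX.clm bar).mulVec
      (worstGain γ T M.Abar M.Bbar M.Qbar M.Rbar r)).eval (Sum.inl a)
    simp only [bar_apply] at h
    exact h
  · have h := hX.clm (dev i)
    simp only [dev_apply] at h
    exact (h.mulVec _).add (worstAgg M γ T r (hX.eval none) hX.agg)

end Known

/-! ### Independence of the noise from the past -/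

namespace Primitives.Standing

variable {N : Primitives n ℓx Ω} {μ : Measure Ω} {T : ℕ} {m : Fin ℓx → ℝ}
  {Cinit : Matrix (Fin ℓx) (Fin ℓx) ℝ} {Cnoise : ℕ → Matrix (Fin ℓx) (Fin ℓx) ℝ}

theorem known_seq (hN : N.Standing μ T m Cinit Cnoise) {s t : ℕ} (hs : s ≤ T) (hst : s < t) :
    Known N μ t (N.seq s) :=
  ⟨(comap_measurable (N.seq s)).mono (le_iSup₂_of_le s hst le_rfl) le_rfl, hN.memLp s hs⟩

theorem known_init (hN : N.Standing μ T m Cinit Cnoise) : Known N μ 1 N.init :=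
  hN.known_seq (Nat.zero_le T) Nat.zero_lt_one

omit [MeasurableSpace Ω] in
theorem seq_eq_noise (N : Primitives n ℓx Ω) {t : ℕ} (ht : 1 ≤ t) : N.seq t = N.noise t := by
  rw [Primitives.seq, if_neg (by omega)]

theorem known_noise (hN : N.Standing μ T m Cinit Cnoise) {t : ℕ} (ht : t ∈ Finset.Icc 1 T) :
    Known N μ (t + 1) (N.noise t) := by
  rw [Finset.mem_Icc] at ht
  rw [← seq_eq_noise N ht.1]
  exact hN.known_seq ht.2 t.lt_succ_self

theorem past_le (hN : N.Standing μ T m Cinit Cnoise) {t : ℕ} (ht : t ≤ T + 1) :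
    N.past t ≤ (inferInstance : MeasurableSpace Ω) :=
  iSup_le fun s => iSup_le fun hs => (hN.measurable s (by omega)).comap_le

theorem indep_past_noise (hN : N.Standing μ T m Cinit Cnoise) {t : ℕ} (ht : t ∈ Finset.Icc 1 T) :
    Indep (N.past t) (MeasurableSpace.comap (N.noise t) inferInstance) μ := by
  rw [Finset.mem_Icc] at ht
  rw [← seq_eq_noise N ht.1]
  have hind := (iIndepFun_iff_iIndep _ _ _).1 hN.indep
  have hle : ∀ k : Fin (T + 1) × Option (Fin n),
      MeasurableSpace.comap (fun ω => N.seq k.1 ω k.2) inferInstance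
        ≤ (inferInstance : MeasurableSpace Ω) := fun k =>
    ((measurable_pi_apply k.2).comp (hN.measurable k.1 (by omega))).comap_le
  have hcomap : ∀ (S : Set (Fin (T + 1) × Option (Fin n))) (s : ℕ) (hs : s < T + 1),
      (∀ a, (⟨s, hs⟩, a) ∈ S) → MeasurableSpace.comap (N.seq s) inferInstance
        ≤ ⨆ k ∈ S, MeasurableSpace.comap (fun ω => N.seq k.1 ω k.2) inferInstance := by
    intro S s hs hS
    rw [← measurable_iff_comap_le]
    refine @measurable_pi_lambda _ _ _ (_) _ _ fun a => ?_
    exact (comap_measurable (fun ω => N.seq s ω a)).mono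
      (le_iSup₂_of_le (⟨s, hs⟩, a) (hS a) le_rfl) le_rfl
  have hdisj : Disjoint {k : Fin (T + 1) × Option (Fin n) | (k.1 : ℕ) < t}
      {k : Fin (T + 1) × Option (Fin n) | (k.1 : ℕ) = t} := by
    rw [Set.disjoint_left]
    intro k h1 h2
    simp only [Set.mem_ofPred_eq] at h1 h2
    omega
  refine indep_of_indep_of_le_left (indep_of_indep_of_le_right
    (indep_iSup_of_disjoint hle hind hdisj) ?_) ?_
  · exact hcomap _ t (by omega) fun _ => rfl
  · exact iSup_le fun s => iSup_le fun hs => hcomap _ s (by omega) fun _ => hs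

theorem integral_noise [IsProbabilityMeasure μ] (hN : N.Standing μ T m Cinit Cnoise) {t : ℕ}
    (ht : t ∈ Finset.Icc 1 T) : ∫ ω, N.noise t ω ∂μ = 0 := by
  have hint := (hN.known_noise ht).memLp
  funext a
  rw [eval_integral fun a => (hint.eval a).integrable one_le_two]
  exact hN.noise_mean t ht a

/-- A centred linear function of the noise is orthogonal to whatever is known beforehand. -/
theorem integral_dotProduct_noise [IsProbabilityMeasure μ] (hN : N.Standing μ T m Cinit Cnoise)
    {t : ℕ} (ht : t ∈ Finset.Icc 1 T) {ι : Type} [Fintype ι] {Y : Ω → ι → ℝ} (hY : Known N μ t Y)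
    (L : Profile n ℓx →L[ℝ] (ι → ℝ)) : ∫ ω, Y ω ⬝ᵥ L (N.noise t ω) ∂μ = 0 := by
  have hw := hN.known_noise ht
  have hW : MemLp (fun ω => L (N.noise t ω)) 2 μ := L.comp_memLp' hw.memLp
  have hi : ∀ j, Integrable (fun ω => Y ω j * L (N.noise t ω) j) μ := fun j =>
    (hY.memLp.eval j).integrable_mul (hW.eval j)
  simp only [dotProduct]
  rw [integral_finsetSum _ fun j _ => hi j]
  refine Finset.sum_eq_zero fun j _ => ?_
  have hind : IndepFun (fun ω => Y ω j) (fun ω => L (N.noise t ω) j) μ := by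
    rw [IndepFun_iff_Indep]
    refine indep_of_indep_of_le_left (indep_of_indep_of_le_right (hN.indep_past_noise ht) ?_) ?_
    · refine measurable_iff_comap_le.1 ?_
      exact ((measurable_pi_apply j).comp L.continuous.measurable).comp
        (comap_measurable (N.noise t))
    · exact measurable_iff_comap_le.1 (hY.eval j).adapted
  rw [hind.integral_fun_mul_eq_mul_integral (hY.memLp.eval j).aestronglyMeasurable
    (hW.eval j).aestronglyMeasurable]
  have h0 : ∫ ω, L (N.noise t ω) j ∂μ = 0 := by
    have := ((ContinuousLinearMap.proj (R := ℝ) (φ := fun _ : ι => ℝ) j).comp L).integral_comp_comm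
      (hw.memLp.integrable one_le_two)
    rw [hN.integral_noise ht, map_zero] at this
    exact this
  rw [h0, mul_zero]

/-- The cross terms between the noise and the noiseless next state have mean zero. -/
theorem integral_pairing_noise [IsProbabilityMeasure μ] (hN : N.Standing μ T m Cinit Cnoise)
    {t : ℕ} (ht : t ∈ Finset.Icc 1 T) {Y : Ω → Profile n ℓx} (hY : Known N μ t Y)
    (K : Matrix (Fin ℓx) (Fin ℓx) ℝ) (Kb : Matrix (Fin ℓx ⊕ Fin ℓx) (Fin ℓx ⊕ Fin ℓx) ℝ) :
    ∫ ω, pairing K Kb (Y ω) (N.noise t ω) ∂μ = 0 := by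
  have hw := (hN.known_noise ht).memLp
  have h1 : ∀ i : Fin n, ∫ ω, dev i (Y ω) ⬝ᵥ (K *ᵥ dev i (N.noise t ω)) ∂μ = 0 := fun i =>
    hN.integral_dotProduct_noise ht (hY.clm (dev i))
      ((LinearMap.toContinuousLinearMap (Matrix.mulVecLin K)).comp (dev i))
  have h2 : ∫ ω, bar (Y ω) ⬝ᵥ (Kb *ᵥ bar (N.noise t ω)) ∂μ = 0 :=
    hN.integral_dotProduct_noise ht (hY.clm bar)
      ((LinearMap.toContinuousLinearMap (Matrix.mulVecLin Kb)).comp bar)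
  have i1 : ∀ i : Fin n, Integrable
      (fun ω => dev i (Y ω) ⬝ᵥ (K *ᵥ dev i (N.noise t ω))) μ := fun i =>
    integrable_dotProduct ((dev i).comp_memLp' hY.memLp)
      (memLp_mulVec K ((dev i).comp_memLp' hw))
  have i2 : Integrable (fun ω => bar (Y ω) ⬝ᵥ (Kb *ᵥ bar (N.noise t ω))) μ :=
    integrable_dotProduct (bar.comp_memLp' hY.memLp) (memLp_mulVec Kb (bar.comp_memLp' hw))
  simp only [pairing]
  rw [integral_add ((integrable_finsetSum _ fun i _ => i1 i).const_mul _) i2, h2,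
    integral_const_mul, integral_finsetSum _ fun i _ => i1 i]
  simp [h1]

/-- The mean-field of `n` independent followers has variance of order `1 / n`. -/
theorem integral_agg_seq [IsProbabilityMeasure μ] (hN : N.Standing μ T m Cinit Cnoise)
    (hn : 0 < n) {s : ℕ} (hs : s ≤ T) {c : Fin ℓx → ℝ} {C : Matrix (Fin ℓx) (Fin ℓx) ℝ}
    (hmean : ∀ i : Fin n, ∫ ω, N.seq s ω (some i) ∂μ = c)
    (hcov : ∀ (i : Fin n) (a : Fin ℓx), covariance (fun ω => N.seq s ω (some i) a)
      (fun ω => N.seq s ω (some i) a) μ = C a a) :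
    ∫ ω, ((N.seq s ω).agg - c) ⬝ᵥ ((N.seq s ω).agg - c) ∂μ = C.trace / n := by
  have hX : ∀ i a, MemLp (fun ω => N.seq s ω (some i) a) 2 μ := fun i a =>
    ((hN.memLp s hs).eval (some i)).eval a
  have hn' : (n : ℝ) ≠ 0 := by positivity
  have hagg : ∀ a ω, (N.seq s ω).agg a = (n : ℝ)⁻¹ * (∑ i : Fin n,
      fun ω => N.seq s ω (some i) a) ω := fun a ω => by
    simp [Profile.agg, Finset.sum_apply]
  have hA : ∀ a, MemLp (fun ω => (N.seq s ω).agg a) 2 μ := fun a => by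
    have h : MemLp (fun ω => aggMap n ℓx (N.seq s ω)) 2 μ :=
      (aggMap n ℓx).comp_memLp' (hN.memLp s hs)
    simp only [aggMap_apply] at h
    exact h.eval a
  have hm : ∀ a, ∫ ω, (N.seq s ω).agg a ∂μ = c a := fun a => by
    have hi : ∀ i : Fin n, ∫ ω, N.seq s ω (some i) a ∂μ = c a := fun i => by
      rw [← hmean i, eval_integral fun a => (hX i a).integrable one_le_two]
    simp only [hagg, Finset.sum_apply]
    rw [integral_const_mul, integral_finsetSum _ fun i _ => (hX i a).integrable one_le_two]
    simp only [hi, Finset.sum_const, Finset.card_univ, Fintype.card_fin, nsmul_eq_mul]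
    rw [inv_mul_cancel_left₀ hn']
  have hv : ∀ a, ∫ ω, ((N.seq s ω).agg a - c a) ^ 2 ∂μ = C a a / n := fun a => by
    rw [← hm a, ← variance_eq_integral (hA a).aemeasurable]
    simp only [hagg]
    rw [variance_const_mul, IndepFun.variance_sum (fun i _ => hX i a)]
    · have : ∀ i : Fin n, variance (fun ω => N.seq s ω (some i) a) μ = C a a := fun i => by
        rw [← covariance_self (hX i a).aemeasurable, hcov]
      simp only [this, Finset.sum_const, Finset.card_univ, Fintype.card_fin, nsmul_eq_mul]
      field_simp
    · intro i _ j _ hij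
      have hne : ((⟨s, by omega⟩ : Fin (T + 1)), some i)
          ≠ ((⟨s, by omega⟩ : Fin (T + 1)), some j) :=
        fun h => hij (Option.some_injective _ (Prod.ext_iff.1 h).2)
      exact (hN.indep.indepFun hne).comp (measurable_pi_apply a) (measurable_pi_apply a)
  have hi : ∀ a, Integrable (fun ω => ((N.seq s ω).agg a - c a) ^ 2) μ := fun a =>
    ((hA a).sub (memLp_const (c a))).integrable_sq
  simp only [dotProduct, Pi.sub_apply, ← sq]
  rw [integral_finsetSum _ fun a _ => hi a]
  simp only [hv, Matrix.trace, Matrix.diag_apply, Finset.sum_div]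

theorem integral_agg_noise [IsProbabilityMeasure μ] (hN : N.Standing μ T m Cinit Cnoise)
    (hn : 0 < n) {t : ℕ} (ht : t ∈ Finset.Icc 1 T) :
    ∫ ω, (N.noise t ω).agg ⬝ᵥ (N.noise t ω).agg ∂μ = (Cnoise t).trace / n := by
  have ht' := Finset.mem_Icc.1 ht
  have h := hN.integral_agg_seq hn ht'.2 (c := 0) (C := Cnoise t)
    (fun i => by
      rw [seq_eq_noise N ht'.1]
      funext a
      have := hN.noise_mean t ht (some i)
      rw [this])
    (fun i a => by
      rw [seq_eq_noise N ht'.1]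
      exact hN.noise_cov t ht i a a)
  simpa only [seq_eq_noise N ht'.1, sub_zero] using h

theorem integral_agg_init [IsProbabilityMeasure μ] (hN : N.Standing μ T m Cinit Cnoise)
    (hn : 0 < n) : ∫ ω, ((N.init ω).agg - m) ⬝ᵥ ((N.init ω).agg - m) ∂μ = Cinit.trace / n :=
  hN.integral_agg_seq hn (Nat.zero_le T) hN.init_mean fun i a => hN.init_cov i a a

end Primitives.Standing

/-! ### The cost of a closed loop -/

/-- `x`, `u`, `d` are the states, actions and disturbances of a non-anticipative closed loop of
finite energy over the horizon. -/
structure ClosedLoop (M : Model ℓx ℓu) (N : Primitives n ℓx Ω) (μ : Measure Ω) (T : ℕ)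
    (x : ℕ → Ω → Profile n ℓx) (u : ℕ → Ω → Profile n ℓu) (d : ℕ → Ω → Profile n ℓx) : Prop where
  init : ∀ ω, x 1 ω = N.init ω
  step : ∀ t ∈ Finset.Icc 1 T, ∀ ω,
    x (t + 1) ω = M.step t (x t ω) (u t ω) (d t ω) (N.noise t ω)
  state : ∀ t ∈ Finset.Icc 1 T, Known N μ t (x t)
  action : ∀ t ∈ Finset.Icc 1 T, Known N μ t (u t)
  disturbance : ∀ t ∈ Finset.Icc 1 T, Known N μ t (d t)

/-- The value of the game: the value function at the initial states, plus what the noises add. -/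
def gameValue (M : Model ℓx ℓu) (γ : ℝ) (T : ℕ) (N : Primitives n ℓx Ω) (μ : Measure Ω) : ℝ :=
  ∫ ω, M.costToGo γ T 1 (N.init ω) ∂μ
    + ∑ t ∈ Finset.Icc 1 T, ∫ ω, M.costToGo γ T (t + 1) (N.noise t ω) ∂μ

namespace ClosedLoop

variable {M : Model ℓx ℓu} {N : Primitives n ℓx Ω} {μ : Measure Ω} {T : ℕ}
  {x : ℕ → Ω → Profile n ℓx} {u : ℕ → Ω → Profile n ℓu} {d : ℕ → Ω → Profile n ℓx}

theorem integrable_cost (hn : 0 < n) (h : ClosedLoop M N μ T x u d) (γ : ℝ) :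
    Integrable (fun ω => ∑ t ∈ Finset.Icc 1 T, M.stageCost γ t (x t ω) (u t ω) (d t ω)) μ :=
  integrable_finsetSum _ fun t ht => M.integrable_stageCost hn γ t (h.state t ht).memLp
    (h.action t ht).memLp (h.disturbance t ht).memLp

/-- Pathwise, the cost up to time `k` telescopes along the value function. -/
theorem sum_stageCost (hn : 0 < n) {γ : ℝ} (hγ : 0 < γ)
    (hr : ∀ t ∈ Finset.Icc 1 T, M.Regular γ T t) (h : ClosedLoop M N μ T x u d) (ω : Ω) (k : ℕ)
    (hk : k ≤ T) : ∑ t ∈ Finset.Icc 1 k, M.stageCost γ t (x t ω) (u t ω) (d t ω)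
      = M.costToGo γ T 1 (N.init ω) - M.costToGo γ T (k + 1) (x (k + 1) ω)
        + ∑ t ∈ Finset.Icc 1 k, (M.gap γ T t (x t ω) (u t ω) (d t ω)
          + M.costToGo γ T (t + 1) (N.noise t ω)
          + 2 * pairing (M.Mdev γ T (t + 1)) (M.Mbar γ T (t + 1))
              (M.step t (x t ω) (u t ω) (d t ω) 0) (N.noise t ω)) := by
  induction k with
  | zero => simp [h.init]
  | succ k ih =>
    have hmem : k + 1 ∈ Finset.Icc 1 T := Finset.mem_Icc.2 (by omega)
    rw [Finset.sum_Icc_succ_top (by omega), Finset.sum_Icc_succ_top (by omega), ih (by omega)]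
    have := Model.stageCost_add_costToGo hγ hn hk (hr _ hmem) (x (k + 1) ω) (u (k + 1) ω)
      (d (k + 1) ω) (N.noise (k + 1) ω)
    rw [h.step _ hmem ω]
    linarith

/-- The expected cost is the value of the game plus the expected gaps. -/
theorem integral_cost [IsProbabilityMeasure μ] {m : Fin ℓx → ℝ}
    {Cinit : Matrix (Fin ℓx) (Fin ℓx) ℝ} {Cnoise : ℕ → Matrix (Fin ℓx) (Fin ℓx) ℝ}
    (hN : N.Standing μ T m Cinit Cnoise) (hn : 0 < n) {γ : ℝ} (hγ : 0 < γ)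
    (hr : ∀ t ∈ Finset.Icc 1 T, M.Regular γ T t) (h : ClosedLoop M N μ T x u d) :
    ∫ ω, ∑ t ∈ Finset.Icc 1 T, M.stageCost γ t (x t ω) (u t ω) (d t ω) ∂μ
      = gameValue M γ T N μ
        + ∑ t ∈ Finset.Icc 1 T, ∫ ω, M.gap γ T t (x t ω) (u t ω) (d t ω) ∂μ := by
  have h0 : ∀ t ∈ Finset.Icc 1 T, Known N μ t
      (fun ω => M.step t (x t ω) (u t ω) (d t ω) 0) := fun t ht =>
    (h.state t ht).step M t (h.action t ht) (h.disturbance t ht) (Known.const 0)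
  have i0 : Integrable (fun ω => M.costToGo γ T 1 (N.init ω)) μ :=
    integrable_pairing _ _ hN.known_init.memLp hN.known_init.memLp
  have i1 : ∀ t ∈ Finset.Icc 1 T, Integrable
      (fun ω => M.gap γ T t (x t ω) (u t ω) (d t ω)) μ := fun t ht =>
    M.integrable_gap γ T t (h.state t ht).memLp (h.action t ht).memLp (h.disturbance t ht).memLp
  have i2 : ∀ t ∈ Finset.Icc 1 T, Integrable
      (fun ω => M.costToGo γ T (t + 1) (N.noise t ω)) μ := fun t ht =>
    integrable_pairing _ _ (hN.known_noise ht).memLp (hN.known_noise ht).memLp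
  have i3 : ∀ t ∈ Finset.Icc 1 T, Integrable (fun ω => 2 * pairing (M.Mdev γ T (t + 1))
      (M.Mbar γ T (t + 1)) (M.step t (x t ω) (u t ω) (d t ω) 0) (N.noise t ω)) μ := fun t ht =>
    (integrable_pairing _ _ (h0 t ht).memLp (hN.known_noise ht).memLp).const_mul 2
  have e : (fun ω => ∑ t ∈ Finset.Icc 1 T, M.stageCost γ t (x t ω) (u t ω) (d t ω))
      = fun ω => M.costToGo γ T 1 (N.init ω)
        + ∑ t ∈ Finset.Icc 1 T, (M.gap γ T t (x t ω) (u t ω) (d t ω)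
          + M.costToGo γ T (t + 1) (N.noise t ω)
          + 2 * pairing (M.Mdev γ T (t + 1)) (M.Mbar γ T (t + 1))
              (M.step t (x t ω) (u t ω) (d t ω) 0) (N.noise t ω)) := by
    funext ω
    rw [h.sum_stageCost hn hγ hr ω T le_rfl, Model.costToGo_terminal, sub_zero]
  have i12 : ∀ t ∈ Finset.Icc 1 T, Integrable (fun ω => M.gap γ T t (x t ω) (u t ω) (d t ω)
      + M.costToGo γ T (t + 1) (N.noise t ω)) μ := fun t ht => (i1 t ht).add (i2 t ht)
  have i123 : ∀ t ∈ Finset.Icc 1 T, Integrable (fun ω => M.gap γ T t (x t ω) (u t ω) (d t ω)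
      + M.costToGo γ T (t + 1) (N.noise t ω) + 2 * pairing (M.Mdev γ T (t + 1))
      (M.Mbar γ T (t + 1)) (M.step t (x t ω) (u t ω) (d t ω) 0) (N.noise t ω)) μ := fun t ht =>
    (i12 t ht).add (i3 t ht)
  rw [e, integral_add i0 (integrable_finsetSum _ i123), integral_finsetSum _ i123, gameValue,
    add_assoc, ← Finset.sum_add_distrib]
  congr 1
  refine Finset.sum_congr rfl fun t ht => ?_
  rw [integral_add (i12 t ht) (i3 t ht), integral_add (i1 t ht) (i2 t ht),
    integral_const_mul, hN.integral_pairing_noise ht (h0 t ht), mul_zero, add_zero, add_comm]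

end ClosedLoop

end Known

open Model

/-! ### Extended expectations -/

section ExtExpectation

variable {Ω : Type*} [MeasurableSpace Ω] {μ : Measure Ω}

theorem extExpectation_eq_integral {f : Ω → ℝ} (hf : Integrable f μ) :
    extExpectation μ f = ((∫ ω, f ω ∂μ : ℝ) : EReal) := by
  have h1 : ∫⁻ ω, ENNReal.ofReal (f ω) ∂μ ≠ ⊤ := hf.lintegral_lt_top.ne
  have h2 : ∫⁻ ω, ENNReal.ofReal (-f ω) ∂μ ≠ ⊤ := hf.neg.lintegral_lt_top.ne
  rw [integral_eq_lintegral_pos_part_sub_lintegral_neg_part hf, EReal.coe_sub,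
    EReal.coe_ennreal_toReal h1, EReal.coe_ennreal_toReal h2]
  rfl

/-- If the negative part is dominated by an integrable function, the extended expectation can only
be `⊤` because the positive part has infinite integral. -/
theorem lintegral_ne_top_of_extExpectation_ne_top {f g : Ω → ℝ} (hg : Integrable g μ)
    (hfg : ∀ ω, -f ω ≤ g ω) (h : extExpectation μ f ≠ ⊤) :
    ∫⁻ ω, ENNReal.ofReal (f ω) ∂μ ≠ ⊤ := by
  intro htop
  have h2 : ∫⁻ ω, ENNReal.ofReal (-f ω) ∂μ ≠ ⊤ :=
    ((lintegral_mono fun ω => ENNReal.ofReal_le_ofReal (hfg ω)).trans_lt hg.lintegral_lt_top).ne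
  apply h
  rw [extExpectation, htop, ← EReal.coe_ennreal_toReal h2, EReal.coe_ennreal_top, EReal.top_sub_coe]

end ExtExpectation

variable {n ℓx ℓu : ℕ} {Ω : Type*} [MeasurableSpace Ω] {μ : Measure Ω} {N : Primitives n ℓx Ω}

/-- For a closed loop of finite energy the extended expectation of the cost is a true expectation:
the value of the game plus the expected gaps. -/
theorem ClosedLoop.extExpectation_cost [IsProbabilityMeasure μ] {M : Model ℓx ℓu} {T : ℕ}
    {m : Fin ℓx → ℝ} {Cinit : Matrix (Fin ℓx) (Fin ℓx) ℝ}
    {Cnoise : ℕ → Matrix (Fin ℓx) (Fin ℓx) ℝ} {x : ℕ → Ω → Profile n ℓx}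
    {u : ℕ → Ω → Profile n ℓu} {d : ℕ → Ω → Profile n ℓx} (h : ClosedLoop M N μ T x u d)
    (hN : N.Standing μ T m Cinit Cnoise) (hn : 0 < n) {γ : ℝ} (hγ : 0 < γ)
    (hr : ∀ t ∈ Finset.Icc 1 T, M.Regular γ T t) :
    extExpectation μ (fun ω => ∑ t ∈ Finset.Icc 1 T, M.stageCost γ t (x t ω) (u t ω) (d t ω))
      = ((gameValue M γ T N μ
        + ∑ t ∈ Finset.Icc 1 T, ∫ ω, M.gap γ T t (x t ω) (u t ω) (d t ω) ∂μ : ℝ) : EReal) := by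
  rw [extExpectation_eq_integral (h.integrable_cost hn γ), h.integral_cost hN hn hγ hr]

/-! ### Coercivity of the control cost -/

/-- A profile with integrable positive definite cost is square integrable. -/
theorem memLp_of_integrable_pairing {ℓ : ℕ} (hn : 0 < n) {K : Matrix (Fin ℓ) (Fin ℓ) ℝ}
    {Kb : Matrix (Fin ℓ ⊕ Fin ℓ) (Fin ℓ ⊕ Fin ℓ) ℝ} (hK : K.PosDef) (hKb : Kb.PosDef)
    {U : Ω → Profile n ℓ} (hU : Measurable U)
    (h : Integrable (fun ω => pairing K Kb (U ω) (U ω)) μ) : MemLp U 2 μ := by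
  have hn' : (0 : ℝ) < n := by positivity
  have nonneg_dev : ∀ p : Profile n ℓ, 0 ≤ (n : ℝ)⁻¹ * ∑ i : Fin n, dev i p ⬝ᵥ (K *ᵥ dev i p) :=
    fun p => mul_nonneg (by positivity)
      (Finset.sum_nonneg fun _ _ => dotProduct_mulVec_nonneg hK.posSemidef _)
  have hb : MemLp (fun ω => bar (U ω)) 2 μ := by
    have hm : Measurable fun ω => bar (U ω) := bar.continuous.measurable.comp hU
    refine memLp_two_of_integrable_dotProduct_self hm
      ((h.const_mul (absSum Kb⁻¹ + 1)).mono' ?_ (ae_of_all _ fun ω => ?_))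
    · have : Continuous fun v : Fin ℓ ⊕ Fin ℓ → ℝ => v ⬝ᵥ v := by fun_prop
      exact (this.measurable.comp hm).aestronglyMeasurable
    · rw [Real.norm_eq_abs, abs_of_nonneg (dotProduct_self_nonneg _)]
      refine (dotProduct_self_le_mul_of_posDef hKb _).trans ?_
      refine mul_le_mul_of_nonneg_left ?_ (by have := absSum_nonneg Kb⁻¹; linarith)
      have := nonneg_dev (U ω)
      unfold pairing
      linarith
  have hd : ∀ i : Fin n, MemLp (fun ω => dev i (U ω)) 2 μ := fun i => by
    have hm : Measurable fun ω => dev i (U ω) := (dev i).continuous.measurable.comp hU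
    refine memLp_two_of_integrable_dotProduct_self hm
      (((h.const_mul n).const_mul (absSum K⁻¹ + 1)).mono' ?_ (ae_of_all _ fun ω => ?_))
    · have : Continuous fun v : Fin ℓ → ℝ => v ⬝ᵥ v := by fun_prop
      exact (this.measurable.comp hm).aestronglyMeasurable
    · rw [Real.norm_eq_abs, abs_of_nonneg (dotProduct_self_nonneg _)]
      refine (dotProduct_self_le_mul_of_posDef hK _).trans ?_
      refine mul_le_mul_of_nonneg_left ?_ (by have := absSum_nonneg K⁻¹; linarith)
      have h1 := dotProduct_mulVec_nonneg hKb.posSemidef (bar (U ω))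
      have h2 := Finset.single_le_sum (f := fun i => dev i (U ω) ⬝ᵥ (K *ᵥ dev i (U ω)))
        (fun i _ => dotProduct_mulVec_nonneg hK.posSemidef _) (Finset.mem_univ i)
      have h3 : (n : ℝ) * pairing K Kb (U ω) (U ω) = ∑ i : Fin n, dev i (U ω) ⬝ᵥ (K *ᵥ dev i (U ω))
          + n * (bar (U ω) ⬝ᵥ (Kb *ᵥ bar (U ω))) := by
        rw [pairing, mul_add, mul_inv_cancel_left₀ hn'.ne']
      rw [h3]
      have h4 : 0 ≤ n * (bar (U ω) ⬝ᵥ (Kb *ᵥ bar (U ω))) := by positivity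
      exact h2.trans (by linarith)
  refine MemLp.of_eval fun k => ?_
  rcases k with _ | i
  · refine MemLp.of_eval fun a => ?_
    simpa only [bar_apply, Sum.elim_inl] using hb.eval (Sum.inl a)
  · have ha : MemLp (fun ω => (U ω).agg) 2 μ := MemLp.of_eval fun a => by
      simpa only [bar_apply, Sum.elim_inr] using hb.eval (Sum.inr a)
    have h' : MemLp (fun ω => dev i (U ω) + (U ω).agg) 2 μ := (hd i).add ha
    simpa only [← some_eq_dev_add_agg] using h'

theorem continuous_pairing_self {ℓ : ℕ} (K : Matrix (Fin ℓ) (Fin ℓ) ℝ)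
    (Kb : Matrix (Fin ℓ ⊕ Fin ℓ) (Fin ℓ ⊕ Fin ℓ) ℝ) :
    Continuous fun p : Profile n ℓ => pairing K Kb p p := by
  unfold pairing
  fun_prop

/-! ### Mean-field sharing strategies against the worst-case feedback -/

/-- The disturbance which agrees with `D` at the times `1, …, k` and vanishes otherwise. The cut
is needed because a `Disturbance` has to be square integrable at all times, also beyond the
horizon, where nothing is assumed about the noises. -/
def Disturbance.truncate (D : ℕ → Ω → Profile n ℓx) (k : ℕ)
    (hD : ∀ t ∈ Finset.Icc 1 k, Known N μ t (D t)) : Disturbance N μ where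
  val t := if t ∈ Finset.Icc 1 k then D t else 0
  adapted t := by
    split_ifs with h
    · exact (hD t h).adapted
    · exact measurable_const
  memLp t := by
    split_ifs with h
    · exact (hD t h).memLp
    · exact MemLp.zero

theorem Disturbance.truncate_val (D : ℕ → Ω → Profile n ℓx) (k : ℕ)
    (hD : ∀ t ∈ Finset.Icc 1 k, Known N μ t (D t)) {t : ℕ} (ht : t ∈ Finset.Icc 1 k) (ω : Ω) :
    (Disturbance.truncate D k hD).val t ω = D t ω := by
  simp only [Disturbance.truncate, if_pos ht]

theorem Disturbance.known (d : Disturbance N μ) (t : ℕ) : Known N μ t (d.val t) :=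
  ⟨d.adapted t, d.memLp t⟩

theorem MFSStrategy.measurable_action (g : MFSStrategy n ℓx ℓu) (t : ℕ) :
    Measurable (g.action t) := by
  have hagg : Measurable (Profile.agg : Profile n ℓx → Fin ℓx → ℝ) :=
    (funext aggMap_apply : ⇑(aggMap n ℓx) = Profile.agg) ▸ (aggMap n ℓx).continuous.measurable
  refine measurable_pi_lambda _ fun k => ?_
  rcases k with _ | i
  · exact (g.measurable_leader t).comp ((measurable_pi_apply none).prodMk hagg)
  · exact (g.measurable_follower t i).comp
      ((measurable_pi_apply (some i)).prodMk (hagg.prodMk (measurable_pi_apply none)))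

namespace Model

variable (M : Model ℓx ℓu)

/-- States under the strategy `g` when the disturbance is the worst-case state feedback. -/
def worstState (γ : ℝ) (T : ℕ) (g : MFSStrategy n ℓx ℓu) (x₁ : Profile n ℓx)
    (w : ℕ → Profile n ℓx) : ℕ → Profile n ℓx
  | 0 => x₁
  | 1 => x₁
  | t + 2 => M.step (t + 1) (worstState γ T g x₁ w (t + 1))
      (g.action (t + 1) (worstState γ T g x₁ w (t + 1)))
      (M.worst γ T (t + 1) (worstState γ T g x₁ w (t + 1))) (w (t + 1))

variable {M}

/-- Causality: under a disturbance which follows the worst-case feedback up to time `k`, the states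
up to time `k + 1` are those of the feedback loop. -/
theorem mfsState_eq_worstState {γ : ℝ} {T : ℕ} {g : MFSStrategy n ℓx ℓu} {x₁ : Profile n ℓx}
    {d w : ℕ → Profile n ℓx} {k : ℕ}
    (hd : ∀ s ∈ Finset.Icc 1 k, d s = M.worst γ T s (M.worstState γ T g x₁ w s)) :
    ∀ t ≤ k + 1, M.mfsState g x₁ d w t = M.worstState γ T g x₁ w t
  | 0, _ => rfl
  | 1, _ => rfl
  | t + 2, ht => by
    rw [mfsState, worstState, mfsState_eq_worstState hd (t + 1) (by omega),
      hd (t + 1) (Finset.mem_Icc.2 (by omega))]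

/-- Only the disturbance makes a stage cost negative, and the stage cost controls the action. -/
theorem actionCost_le_stageCost_add (hn : 0 < n) {γ : ℝ} {T t : ℕ} (hr : M.Regular γ T t)
    (x : Profile n ℓx) (u : Profile n ℓu) (d : Profile n ℓx) :
    pairing (M.R t) (M.Rbar t) u u ≤ M.stageCost γ t x u d + γ ^ 2 * pairing 1 1 d d := by
  have := pairing_self_nonneg hr.Q_psd hr.Qbar_psd x
  rw [M.stageCost_eq hn]
  linarith

variable {T : ℕ} {m : Fin ℓx → ℝ} {Cinit : Matrix (Fin ℓx) (Fin ℓx) ℝ}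
  {Cnoise : ℕ → Matrix (Fin ℓx) (Fin ℓx) ℝ}

theorem mfsCost_eq [IsProbabilityMeasure μ] {γ : ℝ} (hγ : 0 < γ) (hn : 0 < n)
    (hN : N.Standing μ T m Cinit Cnoise)
    (hr : ∀ t ∈ Finset.Icc 1 T, M.Regular γ T t) (g : MFSStrategy n ℓx ℓu) (d : Disturbance N μ)
    {x : ℕ → Ω → Profile n ℓx}
    (hx : ∀ t ω, x t ω = M.mfsState g (N.init ω) (fun s => d.val s ω) (fun s => N.noise s ω) t)
    (h : ClosedLoop M N μ T x (fun t ω => g.action t (x t ω)) d.val) :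
    M.mfsCost γ T N μ g d = ((gameValue M γ T N μ + ∑ t ∈ Finset.Icc 1 T,
      ∫ ω, M.gap γ T t (x t ω) (g.action t (x t ω)) (d.val t ω) ∂μ : ℝ) : EReal) := by
  rw [← h.extExpectation_cost hN hn hγ hr]
  simp only [mfsCost, hx]

/-- A strategy is only assumed measurable, so that its closed loop with the worst-case feedback
might have infinite energy. This does not happen if its cost is finite under every disturbance:
inductively, the feedback stopped after time `k` is an admissible disturbance, its cost is finite,
and by coercivity of the control cost the action of time `k` is square integrable. -/
theorem known_worstState {γ : ℝ} (hn : 0 < n) (hN : N.Standing μ T m Cinit Cnoise)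
    (hr : ∀ t ∈ Finset.Icc 1 T, M.Regular γ T t) (g : MFSStrategy n ℓx ℓu)
    (hfin : ∀ d : Disturbance N μ, M.mfsCost γ T N μ g d ≠ ⊤) (k : ℕ) (hk : k ≤ T) :
    (∀ t ∈ Finset.Icc 1 (k + 1), Known N μ t
      (fun ω => M.worstState γ T g (N.init ω) (fun s => N.noise s ω) t)) ∧
    (∀ t ∈ Finset.Icc 1 k, Known N μ t
      (fun ω => g.action t (M.worstState γ T g (N.init ω) (fun s => N.noise s ω) t))) := by
  induction k with
  | zero =>
    refine ⟨fun t ht => ?_, fun t ht => by simp at ht⟩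
    obtain rfl : t = 1 := by rw [Finset.mem_Icc] at ht; omega
    exact hN.known_init
  | succ k ih =>
    obtain ⟨hX, hU⟩ := ih (by omega)
    set X : ℕ → Ω → Profile n ℓx :=
      fun t ω => M.worstState γ T g (N.init ω) (fun s => N.noise s ω) t with hXdef
    have hmem : k + 1 ∈ Finset.Icc 1 T := Finset.mem_Icc.2 (by omega)
    have hXk : Known N μ (k + 1) (X (k + 1)) := hX _ (Finset.mem_Icc.2 (by omega))
    let d : Disturbance N μ := Disturbance.truncate (fun t ω => M.worst γ T t (X t ω)) (k + 1)
      fun t ht => (hX t ht).worst M γ T t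
    have hd : ∀ ω, ∀ s ∈ Finset.Icc 1 (k + 1), d.val s ω = M.worst γ T s (X s ω) :=
      fun ω s hs => Disturbance.truncate_val _ _ _ hs ω
    let x : ℕ → Ω → Profile n ℓx := fun t ω =>
      M.mfsState g (N.init ω) (fun s => d.val s ω) (fun s => N.noise s ω) t
    let f : Ω → ℝ := fun ω => ∑ t ∈ Finset.Icc 1 T,
      M.stageCost γ t (x t ω) (g.action t (x t ω)) (d.val t ω)
    let q : Ω → ℝ := fun ω => ∑ t ∈ Finset.Icc 1 T, γ ^ 2 * pairing 1 1 (d.val t ω) (d.val t ω)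
    have hq : Integrable q μ := integrable_finsetSum _ fun t _ =>
      (integrable_pairing _ _ (d.memLp t) (d.memLp t)).const_mul _
    have hterm : ∀ ω, ∀ t ∈ Finset.Icc 1 T, 0 ≤ M.stageCost γ t (x t ω) (g.action t (x t ω))
        (d.val t ω) + γ ^ 2 * pairing 1 1 (d.val t ω) (d.val t ω) := fun ω t ht =>
      (pairing_self_nonneg (hr t ht).R_pd.posSemidef (hr t ht).Rbar_pd.posSemidef _).trans
        (actionCost_le_stageCost_add hn (hr t ht) _ _ _)
    have hfq : ∀ ω, pairing (M.R (k + 1)) (M.Rbar (k + 1)) (g.action (k + 1) (X (k + 1) ω))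
        (g.action (k + 1) (X (k + 1) ω)) ≤ f ω + q ω := fun ω => by
      have hxX : x (k + 1) ω = X (k + 1) ω := mfsState_eq_worstState (hd ω) (k + 1) (by omega)
      rw [← hxX]
      refine (actionCost_le_stageCost_add hn (hr _ hmem) (x (k + 1) ω) _ (d.val (k + 1) ω)).trans ?_
      rw [← Finset.sum_add_distrib]
      exact Finset.single_le_sum (f := fun t => M.stageCost γ t (x t ω) (g.action t (x t ω))
        (d.val t ω) + γ ^ 2 * pairing 1 1 (d.val t ω) (d.val t ω)) (hterm ω) hmem
    have hneg : ∀ ω, -f ω ≤ q ω := fun ω => by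
      have := Finset.sum_nonneg (hterm ω)
      rw [Finset.sum_add_distrib] at this
      linarith
    have hftop : ∫⁻ ω, ENNReal.ofReal (f ω) ∂μ ≠ ⊤ :=
      lintegral_ne_top_of_extExpectation_ne_top hq hneg (hfin d)
    have hUad : Measurable[N.past (k + 1)] fun ω => g.action (k + 1) (X (k + 1) ω) :=
      (g.measurable_action (k + 1)).comp hXk.adapted
    have hUm : Measurable fun ω => g.action (k + 1) (X (k + 1) ω) :=
      hUad.mono (hN.past_le (by omega)) le_rfl
    have hint : Integrable (fun ω => pairing (M.R (k + 1)) (M.Rbar (k + 1))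
        (g.action (k + 1) (X (k + 1) ω)) (g.action (k + 1) (X (k + 1) ω))) μ := by
      refine ⟨((continuous_pairing_self _ _).measurable.comp hUm).aestronglyMeasurable, ?_⟩
      rw [hasFiniteIntegral_iff_ofReal (ae_of_all _ fun ω => pairing_self_nonneg
        (hr _ hmem).R_pd.posSemidef (hr _ hmem).Rbar_pd.posSemidef _)]
      calc _ ≤ ∫⁻ ω, (ENNReal.ofReal (f ω) + ENNReal.ofReal (q ω)) ∂μ :=
            lintegral_mono fun ω => (ENNReal.ofReal_le_ofReal (hfq ω)).trans
              ENNReal.ofReal_add_le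
        _ = ∫⁻ ω, ENNReal.ofReal (f ω) ∂μ + ∫⁻ ω, ENNReal.ofReal (q ω) ∂μ :=
            lintegral_add_right' _ hq.aemeasurable.ennreal_ofReal
        _ < ⊤ := ENNReal.add_lt_top.2 ⟨lt_top_iff_ne_top.2 hftop, hq.lintegral_lt_top⟩
    have hUk : Known N μ (k + 1) fun ω => g.action (k + 1) (X (k + 1) ω) :=
      ⟨hUad, memLp_of_integrable_pairing hn (hr _ hmem).R_pd (hr _ hmem).Rbar_pd hUm hint⟩
    have hnext : Known N μ (k + 2) (X (k + 2)) :=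
      (hXk.mono (Nat.le_succ _)).step M (k + 1) (hUk.mono (Nat.le_succ _))
        ((hXk.worst M γ T (k + 1)).mono (Nat.le_succ _)) (hN.known_noise hmem)
    constructor
    · intro t ht
      rw [Finset.mem_Icc] at ht
      rcases ht.2.lt_or_eq with h | rfl
      · exact hX t (Finset.mem_Icc.2 (by omega))
      · exact hnext
    · intro t ht
      rw [Finset.mem_Icc] at ht
      rcases ht.2.lt_or_eq with h | rfl
      · exact hU t (Finset.mem_Icc.2 (by omega))
      · exact hUk

/-- Lower bound: no mean-field sharing strategy guarantees less than the value. -/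
theorem gameValue_le_iSup_mfsCost [IsProbabilityMeasure μ] {γ : ℝ} (hγ : 0 < γ) (hn : 0 < n)
    (hN : N.Standing μ T m Cinit Cnoise) (hr : ∀ t ∈ Finset.Icc 1 T, M.Regular γ T t)
    (g : MFSStrategy n ℓx ℓu) :
    ((gameValue M γ T N μ : ℝ) : EReal) ≤ ⨆ d : Disturbance N μ, M.mfsCost γ T N μ g d := by
  -- If some disturbance has infinite cost there is nothing to prove; otherwise the worst-case
  -- feedback is admissible and its gaps are nonnegative.
  by_cases hfin : ∃ d : Disturbance N μ, M.mfsCost γ T N μ g d = ⊤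
  · obtain ⟨d, hd⟩ := hfin
    exact le_iSup_of_le d (hd ▸ le_top)
  push Not at hfin
  obtain ⟨hX, hU⟩ := known_worstState hn hN hr g hfin T le_rfl
  set X : ℕ → Ω → Profile n ℓx :=
    fun t ω => M.worstState γ T g (N.init ω) (fun s => N.noise s ω) t with hXdef
  have hX' : ∀ t ∈ Finset.Icc 1 T, Known N μ t (X t) := fun t ht =>
    hX t (Finset.mem_Icc.2 (by rw [Finset.mem_Icc] at ht; omega))
  let d : Disturbance N μ := Disturbance.truncate (fun t ω => M.worst γ T t (X t ω)) T
    fun t ht => (hX' t ht).worst M γ T t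
  have hd : ∀ ω, ∀ s ∈ Finset.Icc 1 T, d.val s ω = M.worst γ T s (X s ω) :=
    fun ω s hs => Disturbance.truncate_val _ _ _ hs ω
  let x : ℕ → Ω → Profile n ℓx := fun t ω =>
    M.mfsState g (N.init ω) (fun s => d.val s ω) (fun s => N.noise s ω) t
  have hxX : ∀ t ∈ Finset.Icc 1 T, x t = X t := fun t ht => funext fun ω =>
    mfsState_eq_worstState (hd ω) t (by rw [Finset.mem_Icc] at ht; omega)
  have hloop : ClosedLoop M N μ T x (fun t ω => g.action t (x t ω)) d.val := by
    refine ⟨fun ω => rfl, fun t ht ω => ?_, fun t ht => ?_, fun t ht => ?_, fun t _ => d.known t⟩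
    · obtain ⟨s, rfl⟩ := Nat.exists_eq_add_of_le' (Finset.mem_Icc.1 ht).1
      rfl
    · rw [hxX t ht]; exact hX' t ht
    · simp only [hxX t ht]; exact hU t ht
  refine le_iSup_of_le d ?_
  rw [mfsCost_eq hγ hn hN hr g d (fun _ _ => rfl) hloop, EReal.coe_le_coe_iff]
  refine le_add_of_nonneg_right (Finset.sum_nonneg fun t ht => integral_nonneg fun ω => ?_)
  have hdx : d.val t ω = M.worst γ T t (x t ω) := by rw [hxX t ht]; exact hd ω t ht
  refine gap_nonneg (hr t ht) (fun i => ?_) ?_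
  · rw [hdx]; exact dev_worst hn γ T t _ i
  · rw [hdx]; exact bar_worst hn γ T t _

/-! ### The saddle-point strategy -/

variable (M)

/-- The saddle-point strategy under mean-field sharing. -/
def saddleStrategy (n : ℕ) (γ : ℝ) (T : ℕ) : MFSStrategy n ℓx ℓu where
  leader t y := (M.Lbar γ T t).toBlocks₁₁ *ᵥ y.1 + (M.Lbar γ T t).toBlocks₁₂ *ᵥ y.2
  follower t _ y := M.Ldev γ T t *ᵥ y.1 + (M.Lbar γ T t).toBlocks₂₁ *ᵥ y.2.2
    + ((M.Lbar γ T t).toBlocks₂₂ - M.Ldev γ T t) *ᵥ y.2.1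
  measurable_leader t := Continuous.measurable (by fun_prop)
  measurable_follower t i := Continuous.measurable (by fun_prop)

theorem saddleStrategy_action (γ : ℝ) (T t : ℕ) (x : Profile n ℓx) :
    (M.saddleStrategy n γ T).action t x = M.approxAction γ T t x x.agg := by
  funext k
  rcases k with _ | i <;> rfl

variable {M}

theorem saddleStrategy_closedLoop (γ : ℝ) (hN : N.Standing μ T m Cinit Cnoise)
    (d : Disturbance N μ) {x : ℕ → Ω → Profile n ℓx}
    (hx : ∀ t ω, x t ω = M.mfsState (M.saddleStrategy n γ T) (N.init ω) (fun s => d.val s ω)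
      (fun s => N.noise s ω) t) :
    ClosedLoop M N μ T x (fun t ω => (M.saddleStrategy n γ T).action t (x t ω)) d.val := by
  have hstep : ∀ t ∈ Finset.Icc 1 T, ∀ ω, x (t + 1) ω = M.step t (x t ω)
      ((M.saddleStrategy n γ T).action t (x t ω)) (d.val t ω) (N.noise t ω) := fun t ht ω => by
    obtain ⟨s, rfl⟩ := Nat.exists_eq_add_of_le' (Finset.mem_Icc.1 ht).1
    simp only [hx]
    rfl
  have haction : ∀ t, Known N μ t (x t) →
      Known N μ t (fun ω => (M.saddleStrategy n γ T).action t (x t ω)) := fun t h => by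
    simp only [saddleStrategy_action]
    exact h.approxAction M γ T t h.agg
  have hstate : ∀ t < T, Known N μ (t + 1) (x (t + 1)) := by
    intro t
    induction t with
    | zero =>
      intro _
      have : x 1 = N.init := funext fun ω => hx 1 ω
      rw [this]
      exact hN.known_init
    | succ t ih =>
      intro ht
      have hmem : t + 1 ∈ Finset.Icc 1 T := Finset.mem_Icc.2 (by omega)
      have ih := ih (by omega)
      rw [funext (hstep _ hmem)]
      exact (ih.mono (Nat.le_succ _)).step M (t + 1) ((haction _ ih).mono (Nat.le_succ _))
        ((d.known _).mono (Nat.le_succ _)) (hN.known_noise hmem)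
  have hstate' : ∀ t ∈ Finset.Icc 1 T, Known N μ t (x t) := fun t ht => by
    obtain ⟨s, rfl⟩ := Nat.exists_eq_add_of_le' (Finset.mem_Icc.1 ht).1
    exact hstate s (by rw [Finset.mem_Icc] at ht; omega)
  exact ⟨fun ω => hx 1 ω, hstep, hstate', fun t ht => haction t (hstate' t ht),
    fun t _ => d.known t⟩

/-- Upper bound: the saddle-point strategy guarantees the value. -/
theorem iSup_mfsCost_saddleStrategy_le [IsProbabilityMeasure μ] {γ : ℝ} (hγ : 0 < γ) (hn : 0 < n)
    (hN : N.Standing μ T m Cinit Cnoise) (hr : ∀ t ∈ Finset.Icc 1 T, M.Regular γ T t) :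
    ⨆ d : Disturbance N μ, M.mfsCost γ T N μ (M.saddleStrategy n γ T) d
      ≤ ((gameValue M γ T N μ : ℝ) : EReal) := by
  refine iSup_le fun d => ?_
  rw [mfsCost_eq hγ hn hN hr _ d (fun _ _ => rfl)
    (saddleStrategy_closedLoop γ hN d fun _ _ => rfl), EReal.coe_le_coe_iff]
  refine add_le_of_nonpos_right (Finset.sum_nonpos fun t ht => integral_nonpos fun ω => ?_)
  simp only [saddleStrategy_action]
  refine (gap_le (hr t ht) (dev_approxAction hn γ T t _ _) _).trans ?_
  rw [bar_approxAction hn]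
  simp

/-- `J⋆` is finite, and it is attained by the saddle-point strategy. -/
theorem saddleValue_eq [IsProbabilityMeasure μ] {γ : ℝ} (hγ : 0 < γ) (hn : 0 < n)
    (hN : N.Standing μ T m Cinit Cnoise) (hr : ∀ t ∈ Finset.Icc 1 T, M.Regular γ T t) :
    M.saddleValue γ T N μ = ((gameValue M γ T N μ : ℝ) : EReal) :=
  le_antisymm ((iInf_le _ _).trans (iSup_mfsCost_saddleStrategy_le hγ hn hN hr))
    (le_iInf fun g => gameValue_le_iSup_mfsCost hγ hn hN hr g)

end Model

variable {T : ℕ} {m : Fin ℓx → ℝ} {Cinit : Matrix (Fin ℓx) (Fin ℓx) ℝ}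
  {Cnoise : ℕ → Matrix (Fin ℓx) (Fin ℓx) ℝ}

/-! ### The approximate strategy -/

namespace Model

section ApproxLoop

variable (M : Model ℓx ℓu) (γ : ℝ) (T : ℕ) (obs : Finset ℕ) (m : Fin ℓx → ℝ)
  (dbar : ℕ → (Fin ℓx → ℝ) → (Fin ℓx → ℝ) → Profile n ℓx → Fin ℓx → ℝ) (N : Primitives n ℓx Ω)
  (D : Ω → ℕ → Profile n ℓx → Profile n ℓx)

/-- States and estimates under the approximate strategy as random variables, for a disturbance
`D ω t x` which may depend on chance and on the current state. -/
def approxLoop (t : ℕ) (ω : Ω) : Profile n ℓx × (Fin ℓx → ℝ) :=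
  M.approxState γ T obs m dbar (N.init ω) (D ω) (fun r => N.noise r ω) t

/-- The error (estimate minus mean-field) of the estimate of the mean-field. -/
def approxError (t : ℕ) (ω : Ω) : Fin ℓx → ℝ :=
  (M.approxLoop γ T obs m dbar N D t ω).2 - (M.approxLoop γ T obs m dbar N D t ω).1.agg

variable {M γ T obs m dbar N D}

omit [MeasurableSpace Ω] in
theorem approxLoop_succ_fst {t : ℕ} (ht : 1 ≤ t) (ω : Ω) :
    (M.approxLoop γ T obs m dbar N D (t + 1) ω).1
      = M.step t (M.approxLoop γ T obs m dbar N D t ω).1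
        (M.approxAction γ T t (M.approxLoop γ T obs m dbar N D t ω).1
          (M.approxLoop γ T obs m dbar N D t ω).2)
        (D ω t (M.approxLoop γ T obs m dbar N D t ω).1) (N.noise t ω) := by
  obtain ⟨s, rfl⟩ := Nat.exists_eq_add_of_le' ht
  rfl

omit [MeasurableSpace Ω] in
theorem approxLoop_succ_snd {t : ℕ} (ht : 1 ≤ t) (ω : Ω) :
    (M.approxLoop γ T obs m dbar N D (t + 1) ω).2
      = M.nextEstimate γ T t (M.approxLoop γ T obs m dbar N D t ω).2
        ((M.approxLoop γ T obs m dbar N D t ω).1 none)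
        (dbar t ((M.approxLoop γ T obs m dbar N D t ω).1 none)
          (M.approxLoop γ T obs m dbar N D t ω).2
          (D ω t (M.approxLoop γ T obs m dbar N D t ω).1))
        (signal obs (t + 1) (M.approxLoop γ T obs m dbar N D (t + 1) ω).1) := by
  obtain ⟨s, rfl⟩ := Nat.exists_eq_add_of_le' ht
  rfl

omit [MeasurableSpace Ω] in
theorem approxError_succ (hn : 0 < n) {t : ℕ} (ht : 1 ≤ t) (ω : Ω) :
    M.approxError γ T obs m dbar N D (t + 1) ω = if t + 1 ∈ obs then 0 else
      (M.A t + M.S t + M.B t * M.Ldev γ T t) *ᵥ M.approxError γ T obs m dbar N D t ω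
        + (dbar t ((M.approxLoop γ T obs m dbar N D t ω).1 none)
            (M.approxLoop γ T obs m dbar N D t ω).2
            (D ω t (M.approxLoop γ T obs m dbar N D t ω).1)
          - (D ω t (M.approxLoop γ T obs m dbar N D t ω).1).agg)
        - (N.noise t ω).agg := by
  rw [approxError, approxLoop_succ_snd ht, signal]
  split_ifs with h
  · simp [nextEstimate]
  · rw [approxLoop_succ_fst ht, nextEstimate_none_sub_agg hn]
    rfl

/-- The states and the estimate of the approximate strategy are non-anticipative and square
integrable when the disturbance is. -/
theorem known_approxLoop (hN : N.Standing μ T m Cinit Cnoise) [IsProbabilityMeasure μ]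
    (hD : ∀ t ∈ Finset.Icc 1 T, ∀ X : Ω → Profile n ℓx, Known N μ t X →
      Known N μ t (fun ω => D ω t (X ω)))
    (hdbar : ∀ t ∈ Finset.Icc 1 T, ∀ (X : Ω → Fin ℓx → ℝ) (Y : Ω → Fin ℓx → ℝ)
      (E : Ω → Profile n ℓx), Known N μ t X → Known N μ t Y → Known N μ t E →
      Known N μ t (fun ω => dbar t (X ω) (Y ω) (E ω))) :
    ∀ t ∈ Finset.Icc 1 T,
      Known N μ t (fun ω => (M.approxLoop γ T obs m dbar N D t ω).1) ∧
      Known N μ t (fun ω => (M.approxLoop γ T obs m dbar N D t ω).2) := by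
  have key : ∀ t < T,
      Known N μ (t + 1) (fun ω => (M.approxLoop γ T obs m dbar N D (t + 1) ω).1) ∧
      Known N μ (t + 1) (fun ω => (M.approxLoop γ T obs m dbar N D (t + 1) ω).2) := by
    intro t
    induction t with
    | zero => exact fun _ => ⟨hN.known_init, Known.const m⟩
    | succ t ih =>
      intro ht
      obtain ⟨hX, hY⟩ := ih (by omega)
      have hmem : t + 1 ∈ Finset.Icc 1 T := Finset.mem_Icc.2 (by omega)
      have hd := hD _ hmem _ hX
      have hb := hdbar _ hmem _ _ _ (hX.eval none) hY hd
      have hx : Known N μ (t + 2)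
          (fun ω => (M.approxLoop γ T obs m dbar N D (t + 2) ω).1) := by
        rw [funext fun ω => approxLoop_succ_fst (Nat.le_add_left 1 t) ω]
        exact (hX.mono (Nat.le_succ _)).step M (t + 1)
          ((hX.approxAction M γ T (t + 1) hY).mono (Nat.le_succ _)) (hd.mono (Nat.le_succ _))
          (hN.known_noise hmem)
      refine ⟨hx, ?_⟩
      rw [funext fun ω => approxLoop_succ_snd (Nat.le_add_left 1 t) ω]
      by_cases h : t + 2 ∈ obs
      · simp only [signal, if_pos h, nextEstimate]
        exact hx.agg
      · simp only [signal, if_neg h, nextEstimate]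
        exact (((hY.mulVec _).add ((hX.eval none).mulVec _)).add hb).mono (Nat.le_succ _)
  intro t ht
  obtain ⟨s, rfl⟩ := Nat.exists_eq_add_of_le' (Finset.mem_Icc.1 ht).1
  exact key s (by rw [Finset.mem_Icc] at ht; omega)

theorem closedLoop_approxLoop
    (hD : ∀ t ∈ Finset.Icc 1 T, ∀ X : Ω → Profile n ℓx, Known N μ t X →
      Known N μ t (fun ω => D ω t (X ω)))
    (h : ∀ t ∈ Finset.Icc 1 T,
      Known N μ t (fun ω => (M.approxLoop γ T obs m dbar N D t ω).1) ∧
      Known N μ t (fun ω => (M.approxLoop γ T obs m dbar N D t ω).2)) :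
    ClosedLoop M N μ T (fun t ω => (M.approxLoop γ T obs m dbar N D t ω).1)
      (fun t ω => M.approxAction γ T t (M.approxLoop γ T obs m dbar N D t ω).1
        (M.approxLoop γ T obs m dbar N D t ω).2)
      (fun t ω => D ω t (M.approxLoop γ T obs m dbar N D t ω).1) :=
  ⟨fun _ => rfl, fun _ ht ω => approxLoop_succ_fst (Finset.mem_Icc.1 ht).1 ω,
    fun t ht => (h t ht).1, fun t ht => (h t ht).1.approxAction M γ T t (h t ht).2,
    fun t ht => hD t ht _ (h t ht).1⟩

end ApproxLoop

/-! ### The estimation error is of order `1 / n` in mean square -/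

/-- `n` times a bound on the mean square of the estimation error at time `t + 1` (so that `0` stands
for the initial time), when the error has the dynamics `Γ`. -/
def errBound (Γ : ℕ → Matrix (Fin ℓx) (Fin ℓx) ℝ) (Cinit : Matrix (Fin ℓx) (Fin ℓx) ℝ)
    (Cnoise : ℕ → Matrix (Fin ℓx) (Fin ℓx) ℝ) : ℕ → ℝ
  | 0 => |Cinit.trace|
  | t + 1 => 2 * absSum ((Γ (t + 1))ᵀ * Γ (t + 1)) * errBound Γ Cinit Cnoise t
      + 2 * |(Cnoise (t + 1)).trace|

theorem errBound_nonneg (Γ : ℕ → Matrix (Fin ℓx) (Fin ℓx) ℝ)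
    (Cinit : Matrix (Fin ℓx) (Fin ℓx) ℝ) (Cnoise : ℕ → Matrix (Fin ℓx) (Fin ℓx) ℝ) (t : ℕ) :
    0 ≤ errBound Γ Cinit Cnoise t := by
  induction t with
  | zero => exact abs_nonneg _
  | succ t ih =>
    have := absSum_nonneg ((Γ (t + 1))ᵀ * Γ (t + 1))
    rw [errBound]
    positivity

/-- An error which starts from `m - x̄₁`, is reset to `0` at the observation times and otherwise
follows `e (t + 1) = Γ t e t - w̄ t` has mean square `O(1/n)`, since `x̄₁ - m` and `w̄ t` are
averages of `n` independent centred vectors. -/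
theorem integral_error_le [IsProbabilityMeasure μ] (hn : 0 < n)
    (hN : N.Standing μ T m Cinit Cnoise) {obs : Finset ℕ} {Γ : ℕ → Matrix (Fin ℓx) (Fin ℓx) ℝ}
    {e : ℕ → Ω → Fin ℓx → ℝ} (he : ∀ t ∈ Finset.Icc 1 T, MemLp (e t) 2 μ)
    (h1 : ∀ ω, e 1 ω = m - (N.init ω).agg)
    (hstep : ∀ t ≥ 1, ∀ ω, e (t + 1) ω
      = if t + 1 ∈ obs then 0 else Γ t *ᵥ e t ω - (N.noise t ω).agg) (t : ℕ) (ht : t < T) :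
    ∫ ω, e (t + 1) ω ⬝ᵥ e (t + 1) ω ∂μ ≤ errBound Γ Cinit Cnoise t / n := by
  have hn' : (0 : ℝ) < n := by positivity
  induction t with
  | zero =>
    have : ∀ ω, e 1 ω ⬝ᵥ e 1 ω = ((N.init ω).agg - m) ⬝ᵥ ((N.init ω).agg - m) := fun ω => by
      rw [h1, ← neg_sub, neg_dotProduct_neg]
    simp only [zero_add, this, hN.integral_agg_init hn, errBound]
    gcongr
    exact le_abs_self _
  | succ t ih =>
    have ih := ih (by omega)
    have hmem : t + 1 ∈ Finset.Icc 1 T := Finset.mem_Icc.2 (by omega)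
    by_cases hobs : t + 1 + 1 ∈ obs
    · simp only [hstep (t + 1) (by omega), if_pos hobs, dotProduct_zero, integral_zero]
      exact div_nonneg (errBound_nonneg _ _ _ _) hn'.le
    set a := absSum ((Γ (t + 1))ᵀ * Γ (t + 1)) with ha
    have ha0 : 0 ≤ a := absSum_nonneg _
    have hpt : ∀ ω, e (t + 1 + 1) ω ⬝ᵥ e (t + 1 + 1) ω ≤ 2 * a * (e (t + 1) ω ⬝ᵥ e (t + 1) ω)
        + 2 * ((N.noise (t + 1) ω).agg ⬝ᵥ (N.noise (t + 1) ω).agg) := fun ω => by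
      rw [hstep (t + 1) (by omega), if_neg hobs]
      have h2 := mulVec_dotProduct_mulVec_le (Γ (t + 1)) (e (t + 1) ω)
      have h3 := dotProduct_self_nonneg (Γ (t + 1) *ᵥ e (t + 1) ω + (N.noise (t + 1) ω).agg)
      simp only [sub_dotProduct, dotProduct_sub, add_dotProduct, dotProduct_add] at h3 ⊢
      linarith
    have i1 : Integrable (fun ω => e (t + 1) ω ⬝ᵥ e (t + 1) ω) μ :=
      integrable_dotProduct (he _ hmem) (he _ hmem)
    have hw := (hN.known_noise hmem).agg.memLp
    have i2 : Integrable (fun ω => (N.noise (t + 1) ω).agg ⬝ᵥ (N.noise (t + 1) ω).agg) μ :=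
      integrable_dotProduct hw hw
    have he' : MemLp (e (t + 1 + 1)) 2 μ := he _ (Finset.mem_Icc.2 (by omega))
    calc ∫ ω, e (t + 1 + 1) ω ⬝ᵥ e (t + 1 + 1) ω ∂μ
        ≤ ∫ ω, (2 * a * (e (t + 1) ω ⬝ᵥ e (t + 1) ω)
          + 2 * ((N.noise (t + 1) ω).agg ⬝ᵥ (N.noise (t + 1) ω).agg)) ∂μ :=
          integral_mono (integrable_dotProduct he' he')
            ((i1.const_mul _).add (i2.const_mul _)) hpt
      _ = 2 * a * ∫ ω, e (t + 1) ω ⬝ᵥ e (t + 1) ω ∂μ + 2 * ((Cnoise (t + 1)).trace / n) := by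
          rw [integral_add (i1.const_mul _) (i2.const_mul _), integral_const_mul,
            integral_const_mul, hN.integral_agg_noise hn hmem]
      _ ≤ 2 * a * (errBound Γ Cinit Cnoise t / n) + 2 * (|(Cnoise (t + 1)).trace| / n) := by
          gcongr
          exact le_abs_self _
      _ = errBound Γ Cinit Cnoise (t + 1) / n := by
          rw [errBound, ← ha]; ring

/-- `n` times a bound on the loss of performance caused by the estimation error. -/
def lossBound (M : Model ℓx ℓu) (γ : ℝ) (T : ℕ) (Γ : ℕ → Matrix (Fin ℓx) (Fin ℓx) ℝ)
    (Cinit : Matrix (Fin ℓx) (Fin ℓx) ℝ) (Cnoise : ℕ → Matrix (Fin ℓx) (Fin ℓx) ℝ) : ℝ :=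
  ∑ t ∈ Finset.Icc 1 T, absSum (gapBound γ (M.Bbar t) (M.Rbar t) (M.Mbar γ T (t + 1)))
    * absSum ((M.errGain γ T t)ᵀ * M.errGain γ T t) * errBound Γ Cinit Cnoise (t - 1)

theorem lossBound_nonneg (M : Model ℓx ℓu) (γ : ℝ) (T : ℕ)
    (Γ : ℕ → Matrix (Fin ℓx) (Fin ℓx) ℝ) (Cinit : Matrix (Fin ℓx) (Fin ℓx) ℝ)
    (Cnoise : ℕ → Matrix (Fin ℓx) (Fin ℓx) ℝ) : 0 ≤ M.lossBound γ T Γ Cinit Cnoise :=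
  Finset.sum_nonneg fun _ _ => mul_nonneg (mul_nonneg (absSum_nonneg _) (absSum_nonneg _))
    (errBound_nonneg _ _ _ _)

variable {M : Model ℓx ℓu} {γ : ℝ} {obs : Finset ℕ}
  {dbar : ℕ → (Fin ℓx → ℝ) → (Fin ℓx → ℝ) → Profile n ℓx → Fin ℓx → ℝ}
  {D : Ω → ℕ → Profile n ℓx → Profile n ℓx}

/-- The approximate strategy controls the deviations optimally and the pair (leader, mean-field) up
to `errGain` times the estimation error, so its expected gaps are `O(1/n)` as soon as the error has
autonomous dynamics. -/
theorem sum_integral_gap_approxLoop_le [IsProbabilityMeasure μ] (hn : 0 < n)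
    (hN : N.Standing μ T m Cinit Cnoise) (hr : ∀ t ∈ Finset.Icc 1 T, M.Regular γ T t)
    (hD : ∀ t ∈ Finset.Icc 1 T, ∀ X : Ω → Profile n ℓx, Known N μ t X →
      Known N μ t (fun ω => D ω t (X ω)))
    (h : ∀ t ∈ Finset.Icc 1 T,
      Known N μ t (fun ω => (M.approxLoop γ T obs m dbar N D t ω).1) ∧
      Known N μ t (fun ω => (M.approxLoop γ T obs m dbar N D t ω).2))
    {Γ : ℕ → Matrix (Fin ℓx) (Fin ℓx) ℝ}
    (hstep : ∀ t ≥ 1, ∀ ω, M.approxError γ T obs m dbar N D (t + 1) ω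
      = if t + 1 ∈ obs then 0 else
        Γ t *ᵥ M.approxError γ T obs m dbar N D t ω - (N.noise t ω).agg) :
    ∑ t ∈ Finset.Icc 1 T, ∫ ω, M.gap γ T t (M.approxLoop γ T obs m dbar N D t ω).1
      (M.approxAction γ T t (M.approxLoop γ T obs m dbar N D t ω).1
        (M.approxLoop γ T obs m dbar N D t ω).2)
      (D ω t (M.approxLoop γ T obs m dbar N D t ω).1) ∂μ
      ≤ M.lossBound γ T Γ Cinit Cnoise / n := by
  have he : ∀ t ∈ Finset.Icc 1 T, MemLp (M.approxError γ T obs m dbar N D t) 2 μ := fun t ht =>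
    (h t ht).2.memLp.sub (h t ht).1.agg.memLp
  have hloop := closedLoop_approxLoop hD h
  rw [lossBound, Finset.sum_div]
  refine Finset.sum_le_sum fun t ht => ?_
  have hpt := integral_error_le hn hN he (fun _ => rfl) hstep (t - 1)
    (by rw [Finset.mem_Icc] at ht; omega)
  rw [Nat.sub_add_cancel (Finset.mem_Icc.1 ht).1] at hpt
  set a := absSum (gapBound γ (M.Bbar t) (M.Rbar t) (M.Mbar γ T (t + 1)))
  set b := absSum ((M.errGain γ T t)ᵀ * M.errGain γ T t)
  have ha : 0 ≤ a := absSum_nonneg _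
  have hb : 0 ≤ b := absSum_nonneg _
  calc _ ≤ ∫ ω, a * b * (M.approxError γ T obs m dbar N D t ω
          ⬝ᵥ M.approxError γ T obs m dbar N D t ω) ∂μ := by
        refine integral_mono (M.integrable_gap γ T t (hloop.state t ht).memLp
          (hloop.action t ht).memLp (hloop.disturbance t ht).memLp)
          ((integrable_dotProduct (he t ht) (he t ht)).const_mul _) fun ω => ?_
        refine (gap_le (hr t ht) (dev_approxAction hn γ T t _ _) _).trans ?_
        rw [bar_approxAction hn, mul_assoc]
        exact mul_le_mul_of_nonneg_left (mulVec_dotProduct_mulVec_le _ _) ha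
    _ = a * b * ∫ ω, M.approxError γ T obs m dbar N D t ω
          ⬝ᵥ M.approxError γ T obs m dbar N D t ω ∂μ := integral_const_mul _ _
    _ ≤ a * b * (errBound Γ Cinit Cnoise (t - 1) / n) := by gcongr
    _ = a * b * errBound Γ Cinit Cnoise (t - 1) / n := by ring

/-! ### Performance of the approximate strategy -/

/-- The dynamics of the estimation error when the aggregate disturbance is known. -/
def errDyn (M : Model ℓx ℓu) (γ : ℝ) (T t : ℕ) : Matrix (Fin ℓx) (Fin ℓx) ℝ :=
  M.A t + M.S t + M.B t * M.Ldev γ T t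

/-- The dynamics of the estimation error when the aggregate disturbance is the worst-case one and
is itself estimated. -/
def errDynWorst (M : Model ℓx ℓu) (γ : ℝ) (T t : ℕ) : Matrix (Fin ℓx) (Fin ℓx) ℝ :=
  M.errDyn γ T t + (worstGain γ T M.Abar M.Bbar M.Qbar M.Rbar t).toBlocks₂₂

theorem worstAgg_sub (γ : ℝ) (T t : ℕ) (x0 y z : Fin ℓx → ℝ) :
    M.worstAgg γ T t x0 y - M.worstAgg γ T t x0 z
      = (worstGain γ T M.Abar M.Bbar M.Qbar M.Rbar t).toBlocks₂₂ *ᵥ (y - z) := by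
  set W := worstGain γ T M.Abar M.Bbar M.Qbar M.Rbar t
  have h : ∀ v, M.worstAgg γ T t x0 v = W.toBlocks₂₁ *ᵥ x0 + W.toBlocks₂₂ *ᵥ v := fun v => by
    have hv : W *ᵥ Sum.elim x0 v = _ := congrArg (· *ᵥ Sum.elim x0 v) W.fromBlocks_toBlocks.symm
    funext a
    rw [worstAgg, worstBar, hv, Matrix.fromBlocks_mulVec]
    rfl
  rw [h, h, Matrix.mulVec_sub]
  abel

/-- The approximate strategy loses at most `O(1/n)`, whatever the disturbance. -/
theorem approxCost_le [IsProbabilityMeasure μ] (hγ : 0 < γ) (hn : 0 < n)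
    (hN : N.Standing μ T m Cinit Cnoise) (hr : ∀ t ∈ Finset.Icc 1 T, M.Regular γ T t)
    (d : Disturbance N μ) : M.approxCost γ T N μ obs m d
      ≤ ((gameValue M γ T N μ + M.lossBound γ T (M.errDyn γ T) Cinit Cnoise / n : ℝ) : EReal) := by
  have hD : ∀ t ∈ Finset.Icc 1 T, ∀ X : Ω → Profile n ℓx, Known N μ t X →
      Known N μ t (fun ω => d.val t ω) := fun t _ _ _ => d.known t
  have h := known_approxLoop (M := M) (γ := γ) (obs := obs) (dbar := fun _ _ _ e => e.agg)
    (D := fun ω r _ => d.val r ω) hN hD (fun _ _ _ _ _ _ _ hE => hE.agg)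
  have hloop := closedLoop_approxLoop hD h
  have hcost : M.approxCost γ T N μ obs m d = _ := hloop.extExpectation_cost hN hn hγ hr
  rw [hcost, EReal.coe_le_coe_iff]
  gcongr
  refine sum_integral_gap_approxLoop_le hn hN hr hD h fun t ht ω => ?_
  rw [approxError_succ hn ht, sub_self, add_zero]
  rfl

/-- The approximate strategy does not beat the value: the worst-case feedback in its closed loop is
an admissible disturbance under which it costs at least the value. -/
theorem gameValue_le_iSup_approxCost [IsProbabilityMeasure μ] (hγ : 0 < γ) (hn : 0 < n)
    (hN : N.Standing μ T m Cinit Cnoise) (hr : ∀ t ∈ Finset.Icc 1 T, M.Regular γ T t) :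
    ((gameValue M γ T N μ : ℝ) : EReal)
      ≤ ⨆ d : Disturbance N μ, M.approxCost γ T N μ obs m d := by
  have hDw : ∀ t ∈ Finset.Icc 1 T, ∀ X : Ω → Profile n ℓx, Known N μ t X →
      Known N μ t (fun ω => M.worst γ T t (X ω)) := fun t _ _ hX => hX.worst M γ T t
  have hw := known_approxLoop (M := M) (γ := γ) (obs := obs) (dbar := fun _ _ _ e => e.agg)
    (D := fun _ r x => M.worst γ T r x) hN hDw (fun _ _ _ _ _ _ _ hE => hE.agg)
  set Z := M.approxLoop γ T obs m (fun _ _ _ e => e.agg) N (fun _ r x => M.worst γ T r x)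
    with hZ
  let d : Disturbance N μ := Disturbance.truncate (fun t ω => M.worst γ T t (Z t ω).1) T
    fun t ht => hDw t ht _ (hw t ht).1
  have hd : ∀ ω, ∀ s ∈ Finset.Icc 1 T, d.val s ω = M.worst γ T s (Z s ω).1 :=
    fun ω s hs => Disturbance.truncate_val _ _ _ hs ω
  have hD : ∀ t ∈ Finset.Icc 1 T, ∀ X : Ω → Profile n ℓx, Known N μ t X →
      Known N μ t (fun ω => d.val t ω) := fun t _ _ _ => d.known t
  have h := known_approxLoop (M := M) (γ := γ) (obs := obs) (dbar := fun _ _ _ e => e.agg)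
    (D := fun ω r _ => d.val r ω) hN hD (fun _ _ _ _ _ _ _ hE => hE.agg)
  have hloop := closedLoop_approxLoop hD h
  have hcost : M.approxCost γ T N μ obs m d = _ := hloop.extExpectation_cost hN hn hγ hr
  have heq : ∀ t < T, ∀ ω, M.approxLoop γ T obs m (fun _ _ _ e => e.agg) N
      (fun ω r _ => d.val r ω) (t + 1) ω = Z (t + 1) ω := by
    intro t
    induction t with
    | zero => exact fun _ _ => rfl
    | succ t ih =>
      intro ht ω
      have ih := ih (by omega) ω
      have h1 : (M.approxLoop γ T obs m (fun _ _ _ e => e.agg) N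
          (fun ω r _ => d.val r ω) (t + 1 + 1) ω).1 = (Z (t + 1 + 1) ω).1 := by
        rw [hZ, approxLoop_succ_fst (t := t + 1) (by omega),
          approxLoop_succ_fst (t := t + 1) (by omega), ih,
          hd ω (t + 1) (Finset.mem_Icc.2 (by omega))]
      refine Prod.ext h1 ?_
      rw [hZ, approxLoop_succ_snd (t := t + 1) (by omega),
        approxLoop_succ_snd (t := t + 1) (by omega), h1, ih,
        hd ω (t + 1) (Finset.mem_Icc.2 (by omega))]
  refine le_iSup_of_le d ?_
  rw [hcost, EReal.coe_le_coe_iff]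
  refine le_add_of_nonneg_right (Finset.sum_nonneg fun t ht => integral_nonneg fun ω => ?_)
  have hdx : d.val t ω = M.worst γ T t (M.approxLoop γ T obs m (fun _ _ _ e => e.agg) N
      (fun ω r _ => d.val r ω) t ω).1 := by
    obtain ⟨s, rfl⟩ := Nat.exists_eq_add_of_le' (Finset.mem_Icc.1 ht).1
    rw [heq s (by rw [Finset.mem_Icc] at ht; omega) ω]
    exact hd ω _ ht
  refine gap_nonneg (hr t ht) (fun i => ?_) ?_
  · rw [hdx]; exact dev_worst hn γ T t _ i
  · rw [hdx]; exact bar_worst hn γ T t _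

/-- Against the worst-case feedback, the variant of the approximate strategy which also estimates
the aggregate disturbance has a cost between the value and the value plus `O(1/n)`. -/
theorem approxCostAtWorst_bounds [IsProbabilityMeasure μ] (hγ : 0 < γ) (hn : 0 < n)
    (hN : N.Standing μ T m Cinit Cnoise) (hr : ∀ t ∈ Finset.Icc 1 T, M.Regular γ T t) :
    ∃ J : ℝ, M.approxCostAtWorst γ T N μ obs m = (J : EReal) ∧ gameValue M γ T N μ ≤ J ∧
      J ≤ gameValue M γ T N μ + M.lossBound γ T (M.errDynWorst γ T) Cinit Cnoise / n := by
  have hD : ∀ t ∈ Finset.Icc 1 T, ∀ X : Ω → Profile n ℓx, Known N μ t X →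
      Known N μ t (fun ω => M.worst γ T t (X ω)) := fun t _ _ hX => hX.worst M γ T t
  have h := known_approxLoop (M := M) (γ := γ) (obs := obs)
    (dbar := fun r x0 mhat _ => M.worstAgg γ T r x0 mhat) (D := fun _ r x => M.worst γ T r x)
    hN hD (fun t _ _ _ _ hX hY _ => hX.worstAgg M γ T t hY)
  have hloop := closedLoop_approxLoop hD h
  refine ⟨_, hloop.extExpectation_cost hN hn hγ hr, ?_, ?_⟩
  · refine le_add_of_nonneg_right (Finset.sum_nonneg fun t ht => integral_nonneg fun ω => ?_)
    exact gap_nonneg (hr t ht) (fun i => dev_worst hn γ T t _ i) (bar_worst hn γ T t _)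
  · gcongr
    refine sum_integral_gap_approxLoop_le hn hN hr hD h fun t ht ω => ?_
    rw [approxError_succ hn ht, agg_worst hn, worstAgg_sub, errDynWorst,
      Matrix.add_mulVec (M.errDyn γ T t)]
    rfl

end Model

end LeaderFollower

end

theorem theorem2 {ℓx ℓu : ℕ} (T : ℕ) (γ : ℝ) (hγ : 0 < γ) (M : LeaderFollower.Model ℓx ℓu)
    (hconv : M.Convexity T) (hatt : M.Attenuation γ T)
    (Cinit : Matrix (Fin ℓx) (Fin ℓx) ℝ) (Cnoise : ℕ → Matrix (Fin ℓx) (Fin ℓx) ℝ) :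
    ∃ ε : ℕ → ℝ, (∀ n, 0 ≤ ε n) ∧ Tendsto ε atTop (𝓝 0) ∧
      (ε =O[atTop] fun n : ℕ => 1 / (n : ℝ)) ∧
      ∀ (n : ℕ), 0 < n → ∀ (Ω : Type*) [MeasurableSpace Ω] (μ : Measure Ω)
        [IsProbabilityMeasure μ] (N : LeaderFollower.Primitives n ℓx Ω) (m : Fin ℓx → ℝ),
        N.Standing μ T m Cinit Cnoise → ∀ obs : Finset ℕ,
        ∃ Jstar : ℝ, M.saddleValue γ T N μ = (Jstar : EReal) ∧
          (∃ J : ℝ, (⨆ d : LeaderFollower.Disturbance N μ, M.approxCost γ T N μ obs m d)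
              = (J : EReal) ∧ |J - Jstar| ≤ ε n) ∧
          (∃ J : ℝ, M.approxCostAtWorst γ T N μ obs m = (J : EReal) ∧ |J - Jstar| ≤ ε n) := by
  have hr : ∀ t ∈ Finset.Icc 1 T, M.Regular γ T t := fun t ht =>
    LeaderFollower.Model.regular hγ hconv hatt ht
  set a := M.lossBound γ T (M.errDyn γ T) Cinit Cnoise with ha
  set b := M.lossBound γ T (M.errDynWorst γ T) Cinit Cnoise with hb
  have ha0 : 0 ≤ a := M.lossBound_nonneg γ T _ Cinit Cnoise
  have hb0 : 0 ≤ b := M.lossBound_nonneg γ T _ Cinit Cnoise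
  refine ⟨fun n => (a + b) / n, fun n => by positivity, tendsto_const_div_atTop_nhds_zero_nat _,
    ?_, ?_⟩
  · refine (isBigO_const_mul_self (a + b) (fun n : ℕ => 1 / (n : ℝ)) atTop).congr_left
      fun n => by ring
  intro n hn Ω _ μ _ N m hN obs
  have hn' : (0 : ℝ) < n := by positivity
  have hle : a / n ≤ (a + b) / n ∧ b / n ≤ (a + b) / n := by
    constructor <;> gcongr <;> linarith
  refine ⟨LeaderFollower.gameValue M γ T N μ, LeaderFollower.Model.saddleValue_eq hγ hn hN hr,
    ?_, ?_⟩
  · have hlow := LeaderFollower.Model.gameValue_le_iSup_approxCost (obs := obs) hγ hn hN hr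
    have hup : (⨆ d : LeaderFollower.Disturbance N μ, M.approxCost γ T N μ obs m d)
        ≤ ((LeaderFollower.gameValue M γ T N μ + a / n : ℝ) : EReal) :=
      iSup_le fun d => LeaderFollower.Model.approxCost_le hγ hn hN hr d
    have hbot := ((EReal.bot_lt_coe _).trans_le hlow).ne'
    have htop := (hup.trans_lt (EReal.coe_lt_top _)).ne
    refine ⟨_, (EReal.coe_toReal htop hbot).symm, ?_⟩
    rw [← EReal.coe_toReal htop hbot, EReal.coe_le_coe_iff] at hlow hup
    rw [abs_of_nonneg (by linarith)]
    linarith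
  · obtain ⟨J, hJ, hlow, hup⟩ :=
      LeaderFollower.Model.approxCostAtWorst_bounds (obs := obs) hγ hn hN hr
    refine ⟨J, hJ, ?_⟩
    rw [abs_of_nonneg (by linarith)]
    linarith
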